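/- Let $K$ be an algebraically closed field of characteristic $0$. For a subset $X\subset\mathbb P^n$ of the projective space over $K$ and a linear subspace $V\subset\mathbb P^n$, the $X$-rank $R_X(V)$ is the minimal cardinality of a finite set $S\subset X$ such that $V\subseteq\langle S\rangle$, where $\langle S\rangle$ denotes the linear span of $S$. Let $X\subset\mathbb P^n$ be an integral (i.e. irreducible and reduced) closed subvariety of dimension $m$ which is non-degenerate (i.e. $\langle X\rangle=\mathbb P^n$), and let $V\subset\mathbb P^n$ be a linear subspace such that $V\cap X=\emptyset$. Then $$R_X(V)\le n+1-m.$$ -/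

import Mathlib

open scoped LinearAlgebra.Projectivization

/-- Projective `n`-space over `K`, as the set of lines through the origin of `K ^ (n + 1)`. -/
abbrev PSpace (K : Type*) [Field K] (n : ℕ) : Type _ := ℙ K (Fin (n + 1) → K)

/-- The common zeros in projective space of a set `T` of polynomials in `n + 1` variables
(it is used for sets of homogeneous polynomials, for which the choice of the homogeneous
coordinates `p.rep` of `p` does not matter, see `eval_rep_mk_eq_zero_iff`). -/
def projZeroLocus {K : Type*} [Field K] {n : ℕ} (T : Set (MvPolynomial (Fin (n + 1)) K)) :
    Set (PSpace K n) :=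
  {p | ∀ f ∈ T, MvPolynomial.eval p.rep f = 0}

/-- A projective algebraic set: the common zeros of a set of homogeneous polynomials. -/
def IsProjAlgebraic {K : Type*} [Field K] {n : ℕ} (Z : Set (PSpace K n)) : Prop :=
  ∃ T : Set (MvPolynomial (Fin (n + 1)) K),
    (∀ f ∈ T, ∃ d : ℕ, f.IsHomogeneous d) ∧ Z = projZeroLocus T

theorem eval_rep_mk_eq_zero_iff {K : Type*} [Field K] {n : ℕ}
    {f : MvPolynomial (Fin (n + 1)) K} {d : ℕ} (hf : f.IsHomogeneous d)
    (v : Fin (n + 1) → K) (hv : v ≠ 0) :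
    MvPolynomial.eval (Projectivization.mk K v hv).rep f = 0 ↔ MvPolynomial.eval v f = 0 := by
  obtain ⟨a, ha⟩ := Projectivization.exists_smul_eq_mk_rep K v hv
  have key : MvPolynomial.eval ((a : K) • v) f = (a : K) ^ d * MvPolynomial.eval v f := by
    rw [MvPolynomial.eval_eq, MvPolynomial.eval_eq, Finset.mul_sum]
    refine Finset.sum_congr rfl fun s hs => ?_
    have hdeg : ∑ i ∈ s.support, s i = d := by
      have h1 := hf (MvPolynomial.mem_support_iff.mp hs)
      simpa [Finsupp.weight_apply, Finsupp.sum] using h1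
    simp only [Pi.smul_apply, smul_eq_mul, mul_pow, Finset.prod_mul_distrib]
    rw [Finset.prod_pow_eq_pow_sum, hdeg]
    ring
  rw [← ha, Units.smul_def, key, mul_eq_zero]
  simp

theorem IsProjAlgebraic.empty {K : Type*} [Field K] {n : ℕ} :
    IsProjAlgebraic (∅ : Set (PSpace K n)) := by
  refine ⟨{1}, ?_, ?_⟩
  · rintro f rfl
    exact ⟨0, MvPolynomial.isHomogeneous_one _ _⟩
  · ext p
    simp [projZeroLocus]

theorem IsProjAlgebraic.sInter {K : Type*} [Field K] {n : ℕ} (A : Set (Set (PSpace K n)))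
    (hA : ∀ Z ∈ A, IsProjAlgebraic Z) : IsProjAlgebraic (⋂₀ A) := by
  choose T hT hZ using hA
  refine ⟨⋃ (Z : Set (PSpace K n)) (h : Z ∈ A), T Z h, ?_, ?_⟩
  · intro f hf
    simp only [Set.mem_iUnion] at hf
    obtain ⟨Z, h, hf⟩ := hf
    exact hT Z h f hf
  · ext p
    simp only [Set.mem_sInter, projZeroLocus, Set.mem_iUnion, Set.mem_ofPred_eq]
    constructor
    · rintro hp f ⟨Z, h, hf⟩
      have hpZ := hp Z h
      rw [hZ Z h] at hpZ
      exact hpZ f hf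
    · intro hp Z h
      rw [hZ Z h]
      exact fun f hf => hp f ⟨Z, h, hf⟩

theorem IsProjAlgebraic.union {K : Type*} [Field K] {n : ℕ} (Y : Set (PSpace K n))
    (hY : IsProjAlgebraic Y) (Z : Set (PSpace K n)) (hZ : IsProjAlgebraic Z) :
    IsProjAlgebraic (Y ∪ Z) := by
  obtain ⟨S, hS, rfl⟩ := hY
  obtain ⟨T, hT, rfl⟩ := hZ
  refine ⟨{h | ∃ f ∈ S, ∃ g ∈ T, h = f * g}, ?_, ?_⟩
  · rintro _ ⟨f, hf, g, hg, rfl⟩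
    obtain ⟨d, hd⟩ := hS f hf
    obtain ⟨e, he⟩ := hT g hg
    exact ⟨d + e, hd.mul he⟩
  · ext p
    constructor
    · rintro (hp | hp) _ ⟨f, hf, g, hg, rfl⟩
      · simp [hp f hf]
      · simp [hp g hg]
    · intro hp
      by_contra hcon
      simp only [Set.mem_union, projZeroLocus, Set.mem_ofPred_eq, not_or, not_forall] at hcon
      obtain ⟨⟨f, hf, hfp⟩, g, hg, hgp⟩ := hcon
      have hfg := hp _ ⟨f, hf, g, hg, rfl⟩
      rw [map_mul] at hfg
      exact (mul_ne_zero hfp hgp) hfg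

/-- The Zariski topology on projective space: the closed sets are the projective
algebraic sets. -/
instance zariskiTopology (K : Type*) [Field K] (n : ℕ) : TopologicalSpace (PSpace K n) :=
  TopologicalSpace.ofClosed {Z | IsProjAlgebraic Z} IsProjAlgebraic.empty
    (fun A hA => IsProjAlgebraic.sInter A hA)
    (fun Y hY Z hZ => IsProjAlgebraic.union Y hY Z hZ)

theorem isClosed_iff_isProjAlgebraic {K : Type*} [Field K] {n : ℕ} (Z : Set (PSpace K n)) :
    IsClosed Z ↔ IsProjAlgebraic Z := by
  rw [← isOpen_compl_iff]
  change Zᶜᶜ ∈ {Z | IsProjAlgebraic Z} ↔ _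
  rw [compl_compl, Set.mem_ofPred_eq]

/-- The `X`-rank of a linear subspace `V` of projective space: the minimal cardinality of a finite
set of points of `X` whose linear span contains `V` (and `⊤ : ℕ∞` if there is no such set). -/
noncomputable def subspaceRank {K : Type*} [Field K] {n : ℕ} (X : Set (PSpace K n))
    (V : Projectivization.Subspace K (Fin (n + 1) → K)) : ℕ∞ :=
  sInf {k : ℕ∞ | ∃ S : Finset (PSpace K n), (S : Set (PSpace K n)) ⊆ X ∧
    V ≤ Projectivization.Subspace.span (S : Set (PSpace K n)) ∧ k = (S.card : ℕ∞)}

open scoped IntermediateField.algebraAdjoinAdjoin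

universe u v

-- Enlarge `V` to a linear subspace `W` that is maximal among those disjoint from `X`, of
-- vector-space dimension `r`, and project from `W` to projective `k`-space, where `k + 1 + r = n +
-- 1`. Since `W` misses `X`, the projection restricted to `X` is finite, whence `m ≤ k`; by
-- maximality it is surjective. The fibre over a point lies in the span of `W` and one further
-- vector, of dimension `r + 1`. If the span of some fibre contains `W`, then `r + 1` points of that
-- fibre span `V`, and `r + 1 = n + 1 - k ≤ n + 1 - m`.
--
-- The existence of such a fibre (`exists_forall_fibre_eq_zero`) is proved in the function field `F`
-- of `X`. On a chart, the coordinates `t` of the target are algebraically independent over `K`, `F`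
-- is finite over `L = K(t)`, and non-degeneracy says that the `t i`, `1` and the remaining
-- coordinates `v j` are linearly independent over `K`. It must be shown that `1` and the `v j` are
-- independent over `L`, that is, on the generic fibre (`linearIndependent_adjoin_of_isIntegral`).
-- One slices by one hyperplane pencil `s` at a time, replacing the base field `k` by `k(s)`.
--
-- A slice preserves independence (`LinearIndependent.adjoin_of_isIntegral`): reducing a relation
-- over `k[s]` modulo `s` produces a function on `X` regular on two charts, hence algebraic over
-- `k`, hence in `k`, which contradicts independence over `k`. This needs `k` algebraically closed
-- in `F`, a property that Bertini's theorem (`exists_forall_isAlgebraic_adjoin_mem`) hands on to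
-- `k(s)` for a suitable pencil as long as the slice has positive dimension.
--
-- Finally, independence over `L` descends to a closed fibre off the zeros of one nonzero function
-- (`exists_forall_fibre_linearIndependent`).

-- Algebraic elements in purely transcendental extensions.

attribute [local instance] MvPolynomial.algebraMvPolynomial in
theorem MvPolynomial.mem_range_map_of_isIntegralElem {k Ω ι : Type*} [Field k] [Field Ω]
    [Algebra k Ω] (hΩ : ∀ a : Ω, IsAlgebraic k a → a ∈ (algebraMap k Ω).range)
    {P : MvPolynomial ι Ω} (hP : (MvPolynomial.map (σ := ι) (algebraMap k Ω)).IsIntegralElem P) :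
    ∃ p : MvPolynomial ι k, MvPolynomial.map (algebraMap k Ω) p = P := by
  have hPint : IsIntegral (MvPolynomial ι k) P := hP
  -- A polynomial over `Ω` integral over the polynomials over `k` has coefficients integral over
  -- `k`, and these lie in `k` by `hΩ`.
  rw [MvPolynomial.isIntegral_iff_isIntegral_coeff] at hPint
  rw [← Set.mem_range, MvPolynomial.mem_range_map_iff_coeffs_subset]
  intro c hc
  obtain ⟨m, hm, rfl⟩ := MvPolynomial.mem_coeffs_iff.mp hc
  exact hΩ _ (hPint m).isAlgebraic

/-- An element of the fraction field of a polynomial ring which is integral over that ring is a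
polynomial. -/
theorem AlgebraicIndependent.exists_aeval_eq_of_isIntegral {Ω F ι : Type*} [Field Ω] [Field F]
    [Algebra Ω F] {x : ι → F} (hx : AlgebraicIndependent Ω x) {θ : F}
    (hθ : θ ∈ IntermediateField.adjoin Ω (Set.range x))
    (hint : IsIntegral (Algebra.adjoin Ω (Set.range x)) θ) :
    ∃ P : MvPolynomial ι Ω, MvPolynomial.aeval x P = θ := by
  have hcl : IsIntegrallyClosed (Algebra.adjoin Ω (Set.range x)) :=
    IsIntegrallyClosed.of_equiv hx.aevalEquiv.toRingEquiv
  have hint' : IsIntegral (Algebra.adjoin Ω (Set.range x))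
      (⟨θ, hθ⟩ : IntermediateField.adjoin Ω (Set.range x)) :=
    (isIntegral_algHom_iff (IsScalarTower.toAlgHom (Algebra.adjoin Ω (Set.range x))
      (IntermediateField.adjoin Ω (Set.range x)) F) Subtype.val_injective).mp hint
  obtain ⟨b, hb⟩ := IsIntegrallyClosed.isIntegral_iff.mp hint'
  have hb' : (b : F) = θ := congrArg Subtype.val hb
  have h : (b : F) ∈ (MvPolynomial.aeval x : MvPolynomial ι Ω →ₐ[Ω] F).range :=
    Algebra.adjoin_range_eq_range_aeval Ω x ▸ b.2
  rw [hb'] at h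
  exact h

theorem AlgebraicIndependent.isIntegralElem_aeval {k F ι : Type*} [Field k] [Field F] [Algebra k F]
    {x : ι → F} (hx : AlgebraicIndependent k x) {z : F}
    (hz : IsIntegral (Algebra.adjoin k (Set.range x)) z) :
    (MvPolynomial.aeval x : MvPolynomial ι k →ₐ[k] F).toRingHom.IsIntegralElem z := by
  obtain ⟨f, hf, hf0⟩ := hz
  refine ⟨f.map hx.aevalEquiv.symm.toRingEquiv.toRingHom, hf.map _, ?_⟩
  rw [Polynomial.eval₂_map, ← hf0]
  congr 1
  ext a
  obtain ⟨c, rfl⟩ := hx.aevalEquiv.surjective a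
  simp

/-- A multiple `y * θ` with `y` in `k[x]` is integral over `k[x]`. It lies in `Ω[x]` because that
ring is normal, and its coefficients are then algebraic over `k`, so it lies in `k[x]`. -/
theorem AlgebraicIndependent.mem_adjoin_of_isAlgebraic_adjoin {k Ω F ι : Type*} [Field k] [Field Ω]
    [Field F] [Algebra k Ω] [Algebra Ω F] [Algebra k F] [IsScalarTower k Ω F]
    (hΩ : ∀ a : Ω, IsAlgebraic k a → a ∈ (algebraMap k Ω).range)
    {x : ι → F} (hx : AlgebraicIndependent Ω x) {θ : F}
    (hθ : θ ∈ IntermediateField.adjoin Ω (Set.range x))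
    (hθ' : IsAlgebraic (IntermediateField.adjoin k (Set.range x)) θ) :
    θ ∈ IntermediateField.adjoin k (Set.range x) := by
  have h1 : IsAlgebraic (Algebra.adjoin k (Set.range x)) θ :=
    (IsFractionRing.isAlgebraic_iff (Algebra.adjoin k (Set.range x))
      (IntermediateField.adjoin k (Set.range x)) F).mpr hθ'
  obtain ⟨y, hy0, hy⟩ := h1.exists_integral_multiple
  have hyF : (y : F) ≠ 0 := fun h => hy0 (Subtype.ext h)
  have hyθ : y • θ = (y : F) * θ := rfl
  rw [hyθ] at hy
  obtain ⟨q, hq⟩ : (y : F) ∈ (MvPolynomial.aeval x : MvPolynomial ι k →ₐ[k] F).range :=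
    Algebra.adjoin_range_eq_range_aeval k x ▸ y.2
  replace hq : MvPolynomial.aeval x q = (y : F) := hq
  have hkx : AlgebraicIndependent k x := hx.restrictScalars (algebraMap k Ω).injective
  have hz := hkx.isIntegralElem_aeval hy
  have hsub : Algebra.adjoin k (Set.range x) ≤
      (Algebra.adjoin Ω (Set.range x)).restrictScalars k :=
    Algebra.adjoin_le Algebra.subset_adjoin
  have hyΩ : (y : F) ∈ IntermediateField.adjoin Ω (Set.range x) :=
    IntermediateField.algebra_adjoin_le_adjoin _ _ (hsub y.2)
  have hint : IsIntegral (Algebra.adjoin Ω (Set.range x)) ((y : F) * θ) :=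
    hy.map_of_comp_eq (Subalgebra.inclusion hsub).toRingHom (RingHom.id F) rfl
  obtain ⟨P, hP⟩ := hx.exists_aeval_eq_of_isIntegral (mul_mem hyΩ hθ) hint
  have hcomp : (MvPolynomial.aeval x : MvPolynomial ι Ω →ₐ[Ω] F).toRingHom.comp
      (MvPolynomial.map (algebraMap k Ω)) =
        (MvPolynomial.aeval x : MvPolynomial ι k →ₐ[k] F).toRingHom := by
    ext <;> simp [← IsScalarTower.algebraMap_apply]
  rw [← hP, ← hcomp] at hz
  obtain ⟨p, rfl⟩ := MvPolynomial.mem_range_map_of_isIntegralElem hΩ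
    (RingHom.IsIntegralElem.of_map
      (g := (MvPolynomial.aeval x : MvPolynomial ι Ω →ₐ[Ω] F).toRingHom) hx hz)
  rw [IntermediateField.mem_adjoin_range_iff]
  refine ⟨p, q, ?_⟩
  have h3 : MvPolynomial.aeval x p = (y : F) * θ := by
    rw [← hP, MvPolynomial.aeval_map_algebraMap]
  rw [h3, hq]
  field_simp

/-- Write `θ = p / q`. The family `x` stays independent over `k(θ)`, so `θ * q = p` holds between
polynomials over `k(θ)`; a nonzero coefficient of `q` exhibits `θ` as a quotient of elements of `k`.
-/
theorem AlgebraicIndependent.mem_range_of_isAlgebraic {k F ι : Type*} [Field k] [Field F] [Algebra k F]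
    {x : ι → F} (hx : AlgebraicIndependent k x) {θ : F}
    (hθ : θ ∈ IntermediateField.adjoin k (Set.range x)) (hθ' : IsAlgebraic k θ) :
    θ ∈ (algebraMap k F).range := by
  obtain ⟨p, q, h⟩ := (IntermediateField.mem_adjoin_range_iff k x θ).mp hθ
  by_cases hq : q = 0
  · exact ⟨0, by simp [h, hq]⟩
  have hq' : MvPolynomial.aeval x q ≠ 0 := fun h => hq (hx.eq_zero_of_aeval_eq_zero q h)
  let k' := IntermediateField.adjoin k {θ}
  have : Algebra.IsAlgebraic k k' :=
    IntermediateField.isAlgebraic_adjoin_simple hθ'.isIntegral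
  have hx' : AlgebraicIndependent k' x := hx.extendScalars k'
  let θ' : k' := IntermediateField.AdjoinSimple.gen k θ
  have hmap : ∀ f : MvPolynomial ι k, MvPolynomial.aeval x (MvPolynomial.map (algebraMap k k') f) =
      MvPolynomial.aeval x f := fun f => by
    rw [MvPolynomial.aeval_map_algebraMap]
  have h0 : MvPolynomial.C θ' * MvPolynomial.map (algebraMap k k') q -
      MvPolynomial.map (algebraMap k k') p = 0 := by
    apply hx'.eq_zero_of_aeval_eq_zero
    rw [map_sub, map_mul, hmap, hmap, MvPolynomial.aeval_C, sub_eq_zero]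
    change θ * _ = _
    rw [h]; field_simp
  obtain ⟨m, hm⟩ := MvPolynomial.ne_zero_iff.mp hq
  have h1 := congrArg (MvPolynomial.coeff m) h0
  rw [MvPolynomial.coeff_sub, MvPolynomial.coeff_C_mul, MvPolynomial.coeff_map,
    MvPolynomial.coeff_map, MvPolynomial.coeff_zero, sub_eq_zero] at h1
  refine ⟨MvPolynomial.coeff m p / MvPolynomial.coeff m q, ?_⟩
  have h2 : θ * algebraMap k F (MvPolynomial.coeff m q) = algebraMap k F (MvPolynomial.coeff m p) :=
    congrArg Subtype.val h1
  have hm' : algebraMap k F (MvPolynomial.coeff m q) ≠ 0 := by simpa using hm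
  rw [map_div₀, ← h2]
  field_simp

/-- A family of `n` elements is algebraically independent if the field it generates contains `n`
algebraically independent elements. -/
theorem AlgebraicIndependent.of_forall_mem_adjoin {k F : Type*} [Field k] [Field F] [Algebra k F]
    {n : ℕ} {x y : Fin n → F} (hx : AlgebraicIndependent k x)
    (hxy : ∀ i, x i ∈ IntermediateField.adjoin k (Set.range y)) : AlgebraicIndependent k y := by
  let E := IntermediateField.adjoin k (Set.range y)
  let x' : Fin n → E := fun i => ⟨x i, hxy i⟩
  let y' : Fin n → E := fun i => ⟨y i, IntermediateField.subset_adjoin k _ ⟨i, rfl⟩⟩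
  have hx' : AlgebraicIndependent k x' := AlgebraicIndependent.of_comp E.val hx
  have halg : Algebra.IsAlgebraic (Algebra.adjoin k (Set.range y')) E := by
    refine ⟨fun z => ?_⟩
    have hz := Algebra.IsAlgebraic.isAlgebraic (R := Algebra.adjoin k (Set.range y)) z
    have hle : (Algebra.adjoin k (Set.range y')).map E.val = Algebra.adjoin k (Set.range y) := by
      rw [AlgHom.map_adjoin, ← Set.range_comp]
      rfl
    obtain ⟨f, hf, hf0⟩ := hz
    let φ : Algebra.adjoin k (Set.range y) →+* Algebra.adjoin k (Set.range y') :=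
      { toFun := fun a => ⟨⟨a, IntermediateField.algebra_adjoin_le_adjoin _ _ a.2⟩, by
          obtain ⟨b, hb, hba⟩ : (a : F) ∈ (Algebra.adjoin k (Set.range y')).map E.val := by
            rw [hle]; exact a.2
          have : (⟨a, IntermediateField.algebra_adjoin_le_adjoin _ _ a.2⟩ : E) = b :=
            Subtype.ext hba.symm
          rw [this]; exact hb⟩
        map_one' := rfl
        map_mul' := fun _ _ => rfl
        map_zero' := rfl
        map_add' := fun _ _ => rfl }
    have hφ : Function.Injective φ := fun a b h =>
      Subtype.ext (congrArg (fun c : Algebra.adjoin k (Set.range y') => ((c : E) : F)) h)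
    refine ⟨f.map φ, (Polynomial.map_ne_zero_iff hφ).mpr hf, ?_⟩
    rw [Polynomial.aeval_def, Polynomial.eval₂_map]
    exact hf0
  have hy' : AlgebraicIndependent k y' := by
    refine (Algebra.IsAlgebraic.isTranscendenceBasis_of_lift_le_trdeg_of_finite k y' ?_).1
    exact hx'.lift_cardinalMk_le_trdeg
  exact hy'.map' (f := E.val) Subtype.val_injective

theorem AlgebraicIndependent.tail_adjoin {k F : Type*} [Field k] [Field F] [Algebra k F]
    {n : ℕ} {a : F} {x : Fin n → F}
    (h : AlgebraicIndependent k (Fin.cons a x : Fin (n + 1) → F)) :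
    AlgebraicIndependent (IntermediateField.adjoin k {a}) x := by
  have h1 : AlgebraicIndependent k (Sum.elim x (fun _ : Unit => a)) := by
    refine (algebraicIndependent_equiv' ((Equiv.sumComm _ _).trans
      ((Equiv.sumCongr (Equiv.refl _) (Equiv.refl _)).trans
      ((Equiv.optionEquivSumPUnit (Fin n)).symm.trans (finSuccEquiv n).symm |> fun e =>
        (Equiv.sumComm _ _).trans e))) ?_).mpr h
    ext (i | i) <;> simp
  have h2 := (AlgebraicIndependent.sumElim_iff.mp h1).2
  rw [Set.range_const] at h2
  exact h2.extendScalars _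

/-! ### Bertini's theorem for function fields. -/

/-- Bertini's theorem for function fields: a general member of a pencil of the affine coordinate
hyperplanes has irreducible inverse image. -/
theorem exists_forall_isAlgebraic_adjoin_mem {k F : Type*} [Field k] [CharZero k] [Field F]
    [Algebra k F] (hk : ∀ a : F, IsAlgebraic k a → a ∈ (algebraMap k F).range) {n : ℕ}
    {t : Fin (n + 2) → F} (ht : AlgebraicIndependent k t)
    [FiniteDimensional (IntermediateField.adjoin k (Set.range t)) F] :
    ∃ c : ℕ, ∀ a : F, IsAlgebraic (IntermediateField.adjoin k {t 0 + c * t 1}) a →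
      a ∈ (algebraMap (IntermediateField.adjoin k {t 0 + c * t 1}) F).range := by
  have : CharZero F := charZero_of_injective_algebraMap (algebraMap k F).injective
  let z : ℕ → F := fun c => t 0 + c * t 1
  let M : (c : ℕ) → IntermediateField (IntermediateField.adjoin k {z c}) F :=
    fun c => algebraicClosure _ F
  let L := IntermediateField.adjoin k (Set.range t)
  have : CharZero L := charZero_of_injective_algebraMap (algebraMap k L).injective
  have : Finite (IntermediateField L F) :=
    Field.finite_intermediateField_of_exists_primitive_element L F
      (Field.exists_primitive_element L F)
  -- Pigeonhole: the finite separable extension `F / L` has finitely many intermediate fields, so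
  -- two members of the pencil have closures `M c`, `M c'` generating the same field over `L`.
  obtain ⟨c, c', hne, hcc⟩ := Finite.exists_ne_map_eq_of_infinite
    (fun c => IntermediateField.adjoin L (M c : Set F))
  refine ⟨c, fun θ hθ => ?_⟩
  let u : Fin n → F := fun i => t i.succ.succ
  let x : Fin (n + 1) → F := Fin.cons (z c) u
  have hne' : (c : F) - c' ≠ 0 := sub_ne_zero.mpr (Nat.cast_injective.ne hne)
  have ht1 : t 1 = (z c - z c') / (c - c') := by
    rw [eq_div_iff hne']; simp only [z]; ring
  have ht0 : t 0 = z c - c * t 1 := by simp only [z]; ring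
  have hmem : ∀ E : Subfield F, z c ∈ E → z c' ∈ E → (∀ i, u i ∈ E) → ∀ i, t i ∈ E := by
    intro E h1 h2 h3
    have h4 : t 1 ∈ E := by
      rw [ht1]
      exact div_mem (sub_mem h1 h2) (sub_mem (natCast_mem _ _) (natCast_mem _ _))
    have h5 : t 0 ∈ E := by
      rw [ht0]
      exact sub_mem h1 (mul_mem (natCast_mem _ _) h4)
    intro i
    refine Fin.cases h5 (fun j => Fin.cases h4 (fun l => h3 l) j) i
  have hind : AlgebraicIndependent k (Fin.cons (z c') x : Fin (n + 2) → F) := by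
    refine ht.of_forall_mem_adjoin fun i => ?_
    refine hmem (IntermediateField.adjoin k _).toSubfield ?_ ?_ ?_ i
    · exact IntermediateField.subset_adjoin _ _ ⟨1, rfl⟩
    · exact IntermediateField.subset_adjoin _ _ ⟨0, rfl⟩
    · exact fun i => IntermediateField.subset_adjoin _ _ ⟨i.succ.succ, rfl⟩
  let Ω := M c'
  have : IsScalarTower k Ω F := IsScalarTower.of_algebraMap_eq fun _ => rfl
  have hx : AlgebraicIndependent Ω x := hind.tail_adjoin.extendScalars Ω
  have hxk : AlgebraicIndependent k x := hind.comp Fin.succ (Fin.succ_injective _)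
  -- `θ` belongs to `M c`, hence to `L(M c')`. As `z c` and `z c'` determine `t 0` and `t 1`, and `z
  -- c'` is in `Ω`, this field is contained in `Ω(x)`.
  have hθΩ : θ ∈ IntermediateField.adjoin Ω (Set.range x) := by
    have h1 : θ ∈ IntermediateField.adjoin L (M c' : Set F) := by
      rw [← hcc]
      exact IntermediateField.subset_adjoin L (M c : Set F) ((mem_algebraicClosure_iff' ).mpr hθ.isIntegral)
    have hz' : z c' ∈ Ω := IntermediateField.algebraMap_mem Ω
      (IntermediateField.AdjoinSimple.gen k (z c'))
    have hΩle : (Ω : Set F) ⊆ IntermediateField.adjoin Ω (Set.range x) := fun a ha =>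
      IntermediateField.algebraMap_mem (IntermediateField.adjoin Ω (Set.range x)) (⟨a, ha⟩ : Ω)
    have hkΩ : ∀ a : k, algebraMap k F a ∈ Ω := fun a =>
      IntermediateField.algebraMap_mem Ω (algebraMap k (IntermediateField.adjoin k {z c'}) a)
    refine IntermediateField.adjoin_le_subfield (F := L) (S := (M c' : Set F))
      (K := (IntermediateField.adjoin Ω (Set.range x)).toSubfield) ?_ hΩle h1
    rintro _ ⟨a, rfl⟩
    refine IntermediateField.adjoin_le_subfield (F := k) (S := Set.range t)
      (K := (IntermediateField.adjoin Ω (Set.range x)).toSubfield) ?_ ?_ a.2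
    · rintro _ ⟨b, rfl⟩
      exact hΩle (hkΩ b)
    · rintro _ ⟨i, rfl⟩
      exact hmem (IntermediateField.adjoin Ω (Set.range x)).toSubfield
        (IntermediateField.subset_adjoin Ω _ ⟨0, rfl⟩) (hΩle hz')
        (fun i => IntermediateField.subset_adjoin Ω _ ⟨i.succ, rfl⟩) i
  have hzx : IntermediateField.adjoin k {z c} ≤ IntermediateField.adjoin k (Set.range x) := by
    refine IntermediateField.adjoin.mono _ _ _ ?_
    rintro _ rfl
    exact ⟨0, rfl⟩
  have hθx : IsAlgebraic (IntermediateField.adjoin k (Set.range x)) θ := by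
    obtain ⟨f, hf, hf0⟩ := hθ
    let φ := IntermediateField.inclusion hzx
    refine ⟨f.map φ.toRingHom, (Polynomial.map_ne_zero_iff φ.injective).mpr hf, ?_⟩
    rw [Polynomial.aeval_def, Polynomial.eval₂_map]
    exact hf0
  have hΩk : ∀ a : Ω, IsAlgebraic k a → a ∈ (algebraMap k Ω).range := by
    intro a ha
    obtain ⟨b, hb⟩ := hk (a : F) (ha.algHom (IsScalarTower.toAlgHom k Ω F))
    exact ⟨b, Subtype.ext hb⟩
  have h2 := hx.mem_adjoin_of_isAlgebraic_adjoin hΩk hθΩ hθx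
  -- Now `θ` lies in `k(x) = k(z c)(u)`, purely transcendental over `k(z c)`, and is algebraic over
  -- `k(z c)`.
  refine AlgebraicIndependent.mem_range_of_isAlgebraic hxk.tail_adjoin (θ := θ) ?_ hθ
  refine IntermediateField.adjoin_le_subfield (F := k) (S := Set.range x)
      (K := (IntermediateField.adjoin (IntermediateField.adjoin k {z c})
        (Set.range u)).toSubfield) ?_ ?_ h2
  · rintro _ ⟨a, rfl⟩
    exact IntermediateField.algebraMap_mem (IntermediateField.adjoin
      (IntermediateField.adjoin k {z c}) (Set.range u)) (algebraMap k _ a)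
  · rintro _ ⟨i, rfl⟩
    refine Fin.cases ?_ (fun j => ?_) i
    · exact IntermediateField.algebraMap_mem (IntermediateField.adjoin
        (IntermediateField.adjoin k {z c}) (Set.range u)) (IntermediateField.AdjoinSimple.gen k (z c))
    · exact IntermediateField.subset_adjoin _ _ ⟨j, rfl⟩

/-! ### Functions regular on two charts, and independence after one slice. -/

/-- Since `k[x]` is integrally closed, the minimal polynomial over its fraction field already has
coefficients in `k[x]`. Keeping `L` as a variable allows one field to be presented by the
coordinates of two charts. -/
theorem AlgebraicIndependent.exists_aeval_eq_coeff_minpoly {k F ι : Type*} [Field k] [Field F]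
    [Algebra k F] {x : ι → F} (hx : AlgebraicIndependent k x) {L : IntermediateField k F}
    (hL : L = IntermediateField.adjoin k (Set.range x)) {θ : F}
    (hθ : IsIntegral (Algebra.adjoin k (Set.range x)) θ) (n : ℕ) :
    ∃ P : MvPolynomial ι k, MvPolynomial.aeval x P = ((minpoly L θ).coeff n : F) := by
  subst hL
  have hcl : IsIntegrallyClosed (Algebra.adjoin k (Set.range x)) :=
    IsIntegrallyClosed.of_equiv hx.aevalEquiv.toRingEquiv
  rw [minpoly.isIntegrallyClosed_eq_field_fractions' (IntermediateField.adjoin k (Set.range x)) hθ, Polynomial.coeff_map]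
  obtain ⟨P, hP⟩ := hx.aevalEquiv.surjective
    ((minpoly (Algebra.adjoin k (Set.range x)) θ).coeff n)
  refine ⟨P, ?_⟩
  rw [← hP]
  rfl

/-- Dehomogenization with respect to the first coordinate at infinity. -/
theorem exists_aeval_mul_pow_eq {k F : Type*} [Field k] [Field F] [Algebra k F] {d : ℕ} {s : F}
    (hs : s ≠ 0) (t : Fin d → F) (Q : MvPolynomial (Fin (d + 1)) k) :
    ∃ (N : ℕ) (P : MvPolynomial (Fin (d + 1)) k), P.totalDegree ≤ N ∧
      MvPolynomial.aeval (Fin.cons s⁻¹ (fun i => t i / s) : Fin (d + 1) → F) Q * s ^ N =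
        MvPolynomial.aeval (Fin.cons s t : Fin (d + 1) → F) P := by
  induction Q using MvPolynomial.induction_on with
  | C a => exact ⟨0, MvPolynomial.C a, by simp, by simp⟩
  | add Q₁ Q₂ h₁ h₂ =>
    obtain ⟨N₁, P₁, hd₁, h₁⟩ := h₁
    obtain ⟨N₂, P₂, hd₂, h₂⟩ := h₂
    refine ⟨N₁ + N₂, P₁ * MvPolynomial.X 0 ^ N₂ + P₂ * MvPolynomial.X 0 ^ N₁, ?_, ?_⟩
    · refine (MvPolynomial.totalDegree_add _ _).trans (max_le ?_ ?_)
      · refine (MvPolynomial.totalDegree_mul _ _).trans ?_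
        rw [MvPolynomial.totalDegree_X_pow]; omega
      · refine (MvPolynomial.totalDegree_mul _ _).trans ?_
        rw [MvPolynomial.totalDegree_X_pow]; omega
    · simp only [map_add, map_mul, map_pow, MvPolynomial.aeval_X, Fin.cons_zero, ← h₁, ← h₂]
      ring
  | mul_X Q i h =>
    obtain ⟨N, P, hd, h⟩ := h
    refine Fin.cases ?_ (fun j => ?_) i
    · refine ⟨N + 1, P, by omega, ?_⟩
      rw [← h, map_mul, MvPolynomial.aeval_X, Fin.cons_zero, pow_succ', mul_assoc,
        inv_mul_cancel_left₀ hs]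
    · refine ⟨N + 1, P * MvPolynomial.X j.succ, ?_, ?_⟩
      · refine (MvPolynomial.totalDegree_mul _ _).trans ?_
        rw [MvPolynomial.totalDegree_X]; omega
      · rw [map_mul, map_mul, ← h, MvPolynomial.aeval_X, MvPolynomial.aeval_X, Fin.cons_succ,
          Fin.cons_succ, pow_succ, mul_assoc, mul_assoc, mul_left_comm (t j / s),
          div_mul_cancel₀ _ hs]

theorem IntermediateField.adjoin_cons_inv_div {k F : Type*} [Field k] [Field F] [Algebra k F]
    {d : ℕ} {s : F} (hs : s ≠ 0) (t : Fin d → F) :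
    IntermediateField.adjoin k (Set.range (Fin.cons s t : Fin (d + 1) → F)) =
      IntermediateField.adjoin k
        (Set.range (Fin.cons s⁻¹ (fun i => t i / s) : Fin (d + 1) → F)) := by
  apply le_antisymm <;> rw [IntermediateField.adjoin_le_iff] <;> rintro _ ⟨i, rfl⟩
  · have h0' : s⁻¹ ∈ IntermediateField.adjoin k
        (Set.range (Fin.cons s⁻¹ (fun i => t i / s) : Fin (d + 1) → F)) :=
      IntermediateField.subset_adjoin k _ ⟨0, rfl⟩
    have h0 := inv_mem h0'
    rw [inv_inv] at h0
    refine Fin.cases h0 (fun j => ?_) i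
    have h1 := mul_mem (IntermediateField.subset_adjoin k
      (Set.range (Fin.cons s⁻¹ (fun i => t i / s) : Fin (d + 1) → F)) ⟨j.succ, rfl⟩) h0
    rw [Fin.cons_succ, div_mul_cancel₀ _ hs] at h1
    exact h1
  · have h0 : s ∈ IntermediateField.adjoin k (Set.range (Fin.cons s t : Fin (d + 1) → F)) :=
      IntermediateField.subset_adjoin k _ ⟨0, rfl⟩
    refine Fin.cases (inv_mem h0) (fun j => ?_) i
    exact div_mem (IntermediateField.subset_adjoin k _ ⟨j.succ, rfl⟩) h0

theorem AlgebraicIndependent.cons_inv_div {k F : Type*} [Field k] [Field F] [Algebra k F] {d : ℕ}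
    {s : F} {t : Fin d → F} (h : AlgebraicIndependent k (Fin.cons s t : Fin (d + 1) → F)) :
    AlgebraicIndependent k (Fin.cons s⁻¹ (fun i => t i / s) : Fin (d + 1) → F) := by
  refine h.of_forall_mem_adjoin fun i => ?_
  have hs : s ≠ 0 := h.ne_zero 0
  rw [← IntermediateField.adjoin_cons_inv_div hs t]
  exact IntermediateField.subset_adjoin k _ ⟨i, rfl⟩

/-- A function on a finite cover of projective space which is regular on two affine charts
is constant. -/
theorem AlgebraicIndependent.isAlgebraic_of_isIntegral {k F : Type*} [Field k] [Field F]
    [Algebra k F] {d : ℕ} {s : F} {t : Fin d → F}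
    (h : AlgebraicIndependent k (Fin.cons s t : Fin (d + 1) → F)) {θ : F}
    (h1 : IsIntegral (Algebra.adjoin k (Set.range (Fin.cons s t : Fin (d + 1) → F))) θ)
    (h2 : IsIntegral (Algebra.adjoin k
      (Set.range (Fin.cons s⁻¹ (fun i => t i / s) : Fin (d + 1) → F))) θ) :
    IsAlgebraic k θ := by
  have hs : s ≠ 0 := h.ne_zero 0
  let L := IntermediateField.adjoin k (Set.range (Fin.cons s t : Fin (d + 1) → F))
  have hcoeff : ∀ n, ∃ a : k, algebraMap k L a = (minpoly L θ).coeff n := by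
    intro n
    obtain ⟨P, hP⟩ := h.exists_aeval_eq_coeff_minpoly (L := L) rfl h1 n
    obtain ⟨Q, hQ⟩ := h.cons_inv_div.exists_aeval_eq_coeff_minpoly (L := L)
      (IntermediateField.adjoin_cons_inv_div hs t) h2 n
    obtain ⟨N, P', hP', hN⟩ := exists_aeval_mul_pow_eq hs t Q
    -- The coefficient is `P(s, t)` on one chart and `Q(s⁻¹, t/s)` on the other. Multiplying by `s ^
    -- N` turns the latter into a polynomial of degree at most `N`, so `P` has degree `0`.
    have hPP : P * MvPolynomial.X 0 ^ N = P' := by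
      apply h
      rw [← hN, hQ, ← hP]
      simp
    have hdeg : P.totalDegree = 0 := by
      by_cases hP0 : P = 0
      · simp [hP0]
      have := MvPolynomial.totalDegree_mul_of_isDomain hP0
        (pow_ne_zero N (MvPolynomial.X_ne_zero (R := k) (0 : Fin (d + 1))))
      rw [hPP, MvPolynomial.totalDegree_X_pow] at this
      omega
    rw [MvPolynomial.totalDegree_eq_zero_iff_eq_C] at hdeg
    refine ⟨P.coeff 0, Subtype.ext ?_⟩
    rw [← hP]
    conv_rhs => rw [hdeg, MvPolynomial.aeval_C]
    rfl
  have hA : IsIntegral L θ := h1.map_of_comp_eq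
    (Subalgebra.inclusion (IntermediateField.algebra_adjoin_le_adjoin k _)).toRingHom
    (RingHom.id F) rfl
  obtain ⟨p, hp⟩ := (Polynomial.lifts_iff_coeff_lifts (f := algebraMap k L) (minpoly L θ)).mpr hcoeff
  refine ⟨p, ?_, ?_⟩
  · rintro rfl
    exact minpoly.ne_zero hA (by rw [← hp]; simp)
  · rw [← Polynomial.aeval_map_algebraMap L, ← Polynomial.coe_mapRingHom, hp, minpoly.aeval]

/-- Non-degeneracy passes to the general member of a pencil. -/
theorem LinearIndependent.adjoin_of_isIntegral {k F : Type*} [Field k] [Field F]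
    [Algebra k F] (hk : ∀ a : F, IsAlgebraic k a → a ∈ (algebraMap k F).range) {d : ℕ} {s : F}
    {t : Fin d → F} (h : AlgebraicIndependent k (Fin.cons s t : Fin (d + 1) → F))
    {ι : Type*} [Fintype ι] {e : ι → F}
    (he : LinearIndependent k (fun o : Option ι => o.elim s e))
    (h1 : ∀ i, IsIntegral (Algebra.adjoin k (Set.range (Fin.cons s t : Fin (d + 1) → F))) (e i))
    (h2 : ∀ i, IsIntegral (Algebra.adjoin k
      (Set.range (Fin.cons s⁻¹ (fun i => t i / s) : Fin (d + 1) → F))) (e i / s)) :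
    LinearIndependent (IntermediateField.adjoin k {s}) e := by
  have hs : s ≠ 0 := h.ne_zero 0
  have hsplit : ∀ c : Polynomial k, Polynomial.aeval s c =
      algebraMap k F (c.coeff 0) + s * Polynomial.aeval s c.divX := by
    intro c
    conv_lhs => rw [← Polynomial.X_mul_divX_add c]
    rw [map_add, map_mul, Polynomial.aeval_X, Polynomial.aeval_C, add_comm]
  have key : ∀ c : ι → Polynomial k, ∑ i, Polynomial.aeval s (c i) * e i = 0 →
      ∀ i, (c i).coeff 0 = 0 := by
    intro c hc
    have hW : ∑ i, algebraMap k F ((c i).coeff 0) * e i =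
        s * -∑ i, Polynomial.aeval s (c i).divX * e i := by
      rw [Finset.sum_congr rfl fun i _ => by rw [hsplit (c i), add_mul],
        Finset.sum_add_distrib] at hc
      rw [eq_neg_of_add_eq_zero_left hc, mul_neg, Finset.mul_sum]
      simp only [mul_assoc]
    -- This element is integral over `k[s, t]` as written, and over `k[s⁻¹, t/s]` because by `hW` it
    -- equals the sum of the `(c i).coeff 0 * (e i / s)`. Hence it is a constant `b`, and `hW`
    -- becomes a relation over `k` between `s` and the `e i`.
    obtain ⟨b, hb⟩ := hk (-∑ i, Polynomial.aeval s (c i).divX * e i) (by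
      refine h.isAlgebraic_of_isIntegral ?_ ?_
      · refine (IsIntegral.sum _ fun i _ => IsIntegral.mul ?_ (h1 i)).neg
        have hmem : Polynomial.aeval s (c i).divX ∈
            Algebra.adjoin k (Set.range (Fin.cons s t : Fin (d + 1) → F)) :=
          Algebra.adjoin_mono (by rintro _ rfl; exact ⟨0, rfl⟩)
            (Polynomial.aeval_mem_adjoin_singleton k s)
        exact isIntegral_algebraMap (x := (⟨_, hmem⟩ :
          Algebra.adjoin k (Set.range (Fin.cons s t : Fin (d + 1) → F))))
      · have hdiv : -∑ i, Polynomial.aeval s (c i).divX * e i =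
            ∑ i, algebraMap k F ((c i).coeff 0) * (e i / s) := by
          apply mul_left_cancel₀ hs
          rw [← hW, Finset.mul_sum]
          refine Finset.sum_congr rfl fun i _ => ?_
          field_simp
        rw [hdiv]
        refine IsIntegral.sum _ fun i _ => IsIntegral.mul ?_ (h2 i)
        exact (isIntegral_algebraMap (R := k) (x := (c i).coeff 0)).tower_top)
    rw [← hb] at hW
    rw [Fintype.linearIndependent_iff] at he
    intro i
    refine he (fun o => o.elim (-b) fun i => (c i).coeff 0) ?_ (some i)
    rw [Fintype.sum_option]
    simp only [Option.elim, Algebra.smul_def, hW, map_neg]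
    ring
  -- All constant terms vanish by `key`, so the relation can be divided by `s`, lowering the degree
  -- bound `n`.
  have key2 : ∀ (n : ℕ) (c : ι → Polynomial k), (∀ i, (c i).natDegree ≤ n) →
      ∑ i, Polynomial.aeval s (c i) * e i = 0 → ∀ i, c i = 0 := by
    intro n
    induction n with
    | zero =>
      intro c hn hc i
      rw [Polynomial.eq_C_of_natDegree_le_zero (hn i), key c hc i, map_zero]
    | succ n ih =>
      intro c hn hc i
      have h0 := key c hc
      have hc' : ∑ i, Polynomial.aeval s (c i).divX * e i = 0 := by
        rw [Finset.sum_congr rfl fun i _ => by rw [hsplit (c i), h0 i, map_zero, zero_add, mul_assoc],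
          ← Finset.mul_sum] at hc
        exact (mul_eq_zero.mp hc).resolve_left hs
      have h3 := ih (fun i => (c i).divX) (fun i => by
        rw [Polynomial.natDegree_divX_eq_natDegree_tsub_one]; have := hn i; omega) hc' i
      rw [← Polynomial.X_mul_divX_add (c i), h3, h0]
      simp
  rw [← LinearIndependent.iff_fractionRing (Algebra.adjoin k {s}) (IntermediateField.adjoin k {s}),
    Fintype.linearIndependent_iff]
  intro g hg i
  have hg' : ∀ i, ∃ c : Polynomial k, Polynomial.aeval s c = (g i : F) := fun i => by
    have h : (g i : F) ∈ (Polynomial.aeval s : Polynomial k →ₐ[k] F).range :=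
      Algebra.adjoin_singleton_eq_range_aeval k s ▸ (g i).2
    exact h
  choose c hc using hg'
  have h0 : ∑ i, Polynomial.aeval s (c i) * e i = 0 := by
    simp only [hc]
    exact hg
  have := key2 (Finset.univ.sup fun i => (c i).natDegree) c
    (fun i => Finset.le_sup (f := fun i => (c i).natDegree) (Finset.mem_univ i)) h0 i
  apply Subtype.ext
  rw [← hc i, this]
  simp

/-! ### Iterated slicing down to the generic fibre. -/

theorem IsIntegral.adjoin_of_subset {k k' F : Type*} [Field k] [Field k'] [Field F] [Algebra k k']
    [Algebra k F] [Algebra k' F] [IsScalarTower k k' F] {S S' : Set F}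
    (h : S ⊆ Algebra.adjoin k' S') {x : F} (hx : IsIntegral (Algebra.adjoin k S) x) :
    IsIntegral (Algebra.adjoin k' S') x := by
  have hle : Algebra.adjoin k S ≤ (Algebra.adjoin k' S').restrictScalars k := Algebra.adjoin_le h
  exact hx.map_of_comp_eq (Subalgebra.inclusion hle).toRingHom (RingHom.id F) rfl

theorem IsIntegral.of_mem_subalgebra {k F : Type*} [Field k] [Field F] [Algebra k F]
    {S : Subalgebra k F} {x : F} (hx : x ∈ S) : IsIntegral S x :=
  isIntegral_algebraMap (x := (⟨x, hx⟩ : S))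

/-- Subfields are used here and below because the induction compares intermediate fields over the
different bases `k` and `k(s)`. -/
theorem FiniteDimensional.of_subfield_le {F : Type*} [Field F] {L L' : Subfield F} (h : L ≤ L')
    [FiniteDimensional L F] : FiniteDimensional L' F := by
  let : Algebra L L' := (Subfield.inclusion h).toAlgebra
  have : IsScalarTower L L' F := IsScalarTower.of_algebraMap_eq fun _ => rfl
  exact FiniteDimensional.right L L' F

theorem LinearIndependent.of_subfield_le {F ι : Type*} [Field F] {L L' : Subfield F} (h : L ≤ L')
    {e : ι → F} (he : LinearIndependent L' e) : LinearIndependent L e := by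
  let : Algebra L L' := (Subfield.inclusion h).toAlgebra
  have : IsScalarTower L L' F := IsScalarTower.of_algebraMap_eq fun _ => rfl
  exact he.restrict_scalars' L

/-- Adding multiples of the other `t i` to `t 0` is a unitriangular change of the family. The index
`none` singles out the slicing form. -/
theorem LinearIndependent.option_add_sum {k F : Type*} [Field k] [Field F] [Algebra k F] {d : ℕ}
    {ι : Type*} [Fintype ι] {t : Fin (d + 1) → F} {e : ι → F} (he : LinearIndependent k (Sum.elim t e))
    (c : Fin d → ℕ) :
    LinearIndependent k (fun o : Option (Fin d ⊕ ι) =>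
      o.elim (t 0 + ∑ i, (c i : F) * t i.succ) (Sum.elim (fun i => t i.succ) e)) := by
  rw [Fintype.linearIndependent_iff] at he ⊢
  intro g hg
  have key := he (Sum.elim (Fin.cons (g none) fun i => g (some (Sum.inl i)) + g none * c i)
    fun j => g (some (Sum.inr j))) (by
      rw [← hg]
      simp only [Fintype.sum_sum_type, Fintype.sum_option, Sum.elim_inl, Sum.elim_inr,
        Option.elim, Fin.sum_univ_succ, Fin.cons_zero, Fin.cons_succ, add_smul, smul_add,
        Finset.sum_add_distrib, Finset.smul_sum]
      simp only [Algebra.smul_def, map_mul, map_natCast, mul_assoc]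
      ring)
  have h0 : g none = 0 := key (Sum.inl 0)
  rintro (_ | i | j)
  · exact h0
  · have := key (Sum.inl i.succ)
    simpa [h0] using this
  · exact key (Sum.inr j)

/-- The general fibre of a finite projection of a non-degenerate irreducible variety is
non-degenerate. -/
theorem linearIndependent_adjoin_of_isIntegral {F : Type u} [Field F] {ι : Type*} [Fintype ι]
    (v : ι → F) (d : ℕ) : ∀ {k : Type u} [Field k] [CharZero k] [Algebra k F]
    (_ : d ≠ 0 → ∀ a : F, IsAlgebraic k a → a ∈ (algebraMap k F).range)
    (t : Fin d → F) (_ : AlgebraicIndependent k t)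
    (_ : FiniteDimensional (IntermediateField.adjoin k (Set.range t)) F)
    (_ : LinearIndependent k (Sum.elim t (fun o : Option ι => o.elim 1 v)))
    (_ : ∀ i, IsIntegral (Algebra.adjoin k (Set.range t)) (v i))
    (_ : ∀ l ∈ AddSubmonoid.closure (Set.range t), l ≠ 0 → ∀ i,
      IsIntegral (Algebra.adjoin k (insert l⁻¹ (Set.range fun i => t i / l))) (v i / l)),
    LinearIndependent (IntermediateField.adjoin k (Set.range t)) (fun o : Option ι => o.elim 1 v) := by
  induction d with
  | zero =>
    intro k _ _ _ _ t _ _ he _ _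
    have he' := he.comp Sum.inr Sum.inr_injective
    rw [Fintype.linearIndependent_iff] at he' ⊢
    intro g hg i
    have hmem : ∀ i, ∃ a : k, algebraMap k F a = (g i : F) := fun i => by
      have hbot : IntermediateField.adjoin k (Set.range t) = ⊥ := by
        rw [Set.range_eq_empty, IntermediateField.adjoin_empty]
      exact IntermediateField.mem_bot.mp (hbot.le (g i).2)
    choose a ha using hmem
    have := he' a (by
      rw [← hg]
      refine Finset.sum_congr rfl fun i _ => ?_
      rw [Algebra.smul_def, ha]
      rfl) i
    apply Subtype.ext
    rw [← ha, this, map_zero]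
    rfl
  | succ d ih =>
    intro k _ _ _ hk t ht hfin he h1 h2
    replace hk := hk (Nat.succ_ne_zero d)
    -- a general coordinate
    obtain ⟨c, hc⟩ : ∃ c : Fin d → ℕ, d ≠ 0 → ∀ a : F,
        IsAlgebraic (IntermediateField.adjoin k {t 0 + ∑ i, (c i : F) * t i.succ}) a →
          a ∈ (algebraMap (IntermediateField.adjoin k {t 0 + ∑ i, (c i : F) * t i.succ}) F).range := by
      -- When `d = 0` this slice is the last one: `F` is then finite over `k(s)`, and algebraic
      -- closedness of `k(s)` is neither expected nor needed.
      cases d with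
      | zero => exact ⟨0, fun h => absurd rfl h⟩
      | succ d =>
        obtain ⟨c, hc⟩ := exists_forall_isAlgebraic_adjoin_mem hk ht
        refine ⟨Pi.single 0 c, fun _ => ?_⟩
        have : ∑ i : Fin (d + 1), ((Pi.single 0 c : Fin (d + 1) → ℕ) i : F) * t i.succ =
            c * t 1 := by
          rw [Finset.sum_eq_single 0]
          · simp
          · intro i _ hi; simp [Pi.single_eq_of_ne hi]
          · simp
        rw [this]
        exact hc
    set s := t 0 + ∑ i, (c i : F) * t i.succ with hs_def
    have ht0 : t 0 = s - ∑ i, (c i : F) * t i.succ := by rw [hs_def]; ring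
    let t' : Fin d → F := fun i => t i.succ
    -- The coefficients of every slicing form are natural numbers, so the integrality hypothesis at
    -- infinity is only needed on the additive monoid generated by `t`.
    have hs_mem : s ∈ AddSubmonoid.closure (Set.range t) := by
      refine add_mem (AddSubmonoid.subset_closure ⟨0, rfl⟩) (sum_mem fun i _ => ?_)
      rw [← nsmul_eq_mul]
      exact nsmul_mem (AddSubmonoid.subset_closure (Set.mem_range_self _)) _
    have hst : AlgebraicIndependent k (Fin.cons s t' : Fin (d + 1) → F) := by
      refine ht.of_forall_mem_adjoin fun i => ?_
      have hi : ∀ i : Fin d, t i.succ ∈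
          IntermediateField.adjoin k (Set.range (Fin.cons s t' : Fin (d + 1) → F)) :=
        fun i => IntermediateField.subset_adjoin k _ ⟨Fin.succ i, rfl⟩
      have h0 : s ∈ IntermediateField.adjoin k (Set.range (Fin.cons s t' : Fin (d + 1) → F)) :=
        IntermediateField.subset_adjoin k _ ⟨0, rfl⟩
      refine Fin.cases ?_ hi i
      rw [ht0]
      exact sub_mem h0
        (sum_mem fun i _ => mul_mem (natCast_mem _ _) (hi i))
    have hs0 : s ≠ 0 := hst.ne_zero 0
    have he' := he.option_add_sum c
    have hstep := LinearIndependent.adjoin_of_isIntegral hk hst he' (by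
      rintro (i | _ | i)
      · exact IsIntegral.of_mem_subalgebra (Algebra.subset_adjoin ⟨i.succ, rfl⟩)
      · exact isIntegral_one
      · refine (h1 i).adjoin_of_subset ?_
        have hi : ∀ i : Fin d, t i.succ ∈
            Algebra.adjoin k (Set.range (Fin.cons s t' : Fin (d + 1) → F)) :=
          fun i => Algebra.subset_adjoin ⟨i.succ, rfl⟩
        rintro _ ⟨j, rfl⟩
        refine Fin.cases ?_ hi j
        rw [ht0]
        exact sub_mem (Algebra.subset_adjoin ⟨0, rfl⟩)
          (sum_mem fun i _ => mul_mem (natCast_mem _ _) (hi i))) (by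
      have hi : ∀ i : Fin d, t i.succ / s ∈
          Algebra.adjoin k (Set.range (Fin.cons s⁻¹ (fun i => t' i / s) : Fin (d + 1) → F)) :=
        fun i => Algebra.subset_adjoin ⟨i.succ, rfl⟩
      have hinv : s⁻¹ ∈
          Algebra.adjoin k (Set.range (Fin.cons s⁻¹ (fun i => t' i / s) : Fin (d + 1) → F)) :=
        Algebra.subset_adjoin ⟨0, rfl⟩
      rintro (i | _ | i)
      · exact IsIntegral.of_mem_subalgebra (hi i)
      · exact IsIntegral.of_mem_subalgebra (by rw [← one_div] at hinv; simpa using hinv)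
      · refine (h2 s hs_mem hs0 i).adjoin_of_subset ?_
        refine Set.insert_subset hinv ?_
        rintro _ ⟨j, rfl⟩
        refine Fin.cases ?_ hi j
        simp only
        rw [ht0, sub_div, div_self hs0, Finset.sum_div]
        refine sub_mem (one_mem _) (sum_mem fun i _ => ?_)
        rw [mul_div_assoc]
        exact mul_mem (natCast_mem _ _) (hi i))
    let k' := IntermediateField.adjoin k {s}
    have hsk' : ∀ S : Subalgebra k' F, s ∈ S := fun S =>
      S.algebraMap_mem (IntermediateField.AdjoinSimple.gen k s)
    have hle : (IntermediateField.adjoin k (Set.range t)).toSubfield ≤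
        (IntermediateField.adjoin k' (Set.range t')).toSubfield := by
      intro x hx
      refine IntermediateField.adjoin_le_subfield (F := k) (S := Set.range t)
        (K := (IntermediateField.adjoin k' (Set.range t')).toSubfield) ?_ ?_ hx
      · rintro _ ⟨a, rfl⟩
        exact IntermediateField.algebraMap_mem (IntermediateField.adjoin k' (Set.range t'))
          (algebraMap k k' a)
      · have hi : ∀ i : Fin d, t i.succ ∈ IntermediateField.adjoin k' (Set.range t') :=
          fun i => IntermediateField.subset_adjoin k' _ ⟨i, rfl⟩
        rintro _ ⟨j, rfl⟩
        refine Fin.cases ?_ hi j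
        rw [ht0]
        have h3 : s - ∑ i, (c i : F) * t i.succ ∈ IntermediateField.adjoin k' (Set.range t') :=
          sub_mem (hsk' (IntermediateField.adjoin k' (Set.range t')).toSubalgebra)
            (sum_mem fun i _ => mul_mem (natCast_mem _ _) (hi i))
        exact h3
    have hfin' : FiniteDimensional (IntermediateField.adjoin k (Set.range t)).toSubfield F := hfin
    have := ih (k := k') hc t' hst.tail_adjoin (FiniteDimensional.of_subfield_le hle) hstep (by
      intro i
      refine (h1 i).adjoin_of_subset ?_
      have hi : ∀ i : Fin d, t i.succ ∈ Algebra.adjoin k' (Set.range t') :=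
          fun i => Algebra.subset_adjoin ⟨i, rfl⟩
      rintro _ ⟨j, rfl⟩
      refine Fin.cases ?_ hi j
      rw [ht0]
      exact sub_mem (hsk' _) (sum_mem fun i _ => mul_mem (natCast_mem _ _) (hi i))) (by
      intro l hl hl0 i
      have hl' : l ∈ AddSubmonoid.closure (Set.range t) :=
        AddSubmonoid.closure_mono (by rintro _ ⟨i, rfl⟩; exact ⟨_, rfl⟩) hl
      refine (h2 l hl' hl0 i).adjoin_of_subset ?_
      have hinv : l⁻¹ ∈ Algebra.adjoin k' (insert l⁻¹ (Set.range fun i => t' i / l)) :=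
        Algebra.subset_adjoin (Set.mem_insert _ _)
      have hi : ∀ i : Fin d, t i.succ / l ∈
          Algebra.adjoin k' (insert l⁻¹ (Set.range fun i => t' i / l)) :=
        fun i => Algebra.subset_adjoin (Set.mem_insert_of_mem _ ⟨i, rfl⟩)
      refine Set.insert_subset hinv ?_
      rintro _ ⟨j, rfl⟩
      refine Fin.cases ?_ hi j
      simp only
      rw [ht0, sub_div, Finset.sum_div, div_eq_mul_inv]
      refine sub_mem (mul_mem (hsk' _) hinv) (sum_mem fun i _ => ?_)
      rw [mul_div_assoc]
      exact mul_mem (natCast_mem _ _) (hi i))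
    exact LinearIndependent.of_subfield_le hle this

/-! ### Specialization from the generic fibre to a closed fibre. -/

/-- A surjection from a ring onto an algebraically closed field extends to every integral
extension. -/
theorem RingHom.exists_extension_of_isIntegral {D C K : Type*} [CommRing D] [CommRing C] [Field K]
    [IsAlgClosed K] [Algebra D C] [FaithfulSMul D C] [Algebra.IsIntegral D C] (ψ : D →+* K)
    (hψ : Function.Surjective ψ) : ∃ φ : C →+* K, φ.comp (algebraMap D C) = ψ := by
  have hmax : (RingHom.ker ψ).IsMaximal := RingHom.ker_isMaximal_of_surjective ψ hψ
  -- Lying over: `C ⧸ Q` is a field integral over `D ⧸ ker ψ`, identified with `K`, so it equals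
  -- `K`.
  obtain ⟨Q, hQ, hQc⟩ := Ideal.exists_ideal_over_maximal_of_isIntegral (S := C) (RingHom.ker ψ) (by
    rw [(RingHom.injective_iff_ker_eq_bot _).mp (FaithfulSMul.algebraMap_injective D C)]
    exact bot_le)
  have hker : RingHom.ker ψ ≤ RingHom.ker ((Ideal.Quotient.mk Q).comp (algebraMap D C)) := by
    intro d hd
    rw [← hQc] at hd
    exact Ideal.Quotient.eq_zero_iff_mem.mpr hd
  let i : K →+* C ⧸ Q := RingHom.liftOfSurjective ψ hψ ⟨_, hker⟩
  have hi : ∀ d, i (ψ d) = Ideal.Quotient.mk Q (algebraMap D C d) := fun d =>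
    RingHom.liftOfRightInverse_comp_apply ψ _ (Function.rightInverse_surjInv hψ) ⟨_, hker⟩ d
  let : Algebra K (C ⧸ Q) := i.toAlgebra
  have hint : Algebra.IsIntegral K (C ⧸ Q) := by
    refine ⟨fun c => ?_⟩
    obtain ⟨c, rfl⟩ := Ideal.Quotient.mk_surjective c
    obtain ⟨f, hf, hf0⟩ := Algebra.IsIntegral.isIntegral (R := D) c
    refine ⟨f.map ψ, hf.map ψ, ?_⟩
    rw [Polynomial.eval₂_map]
    have : (algebraMap K (C ⧸ Q)).comp ψ = (Ideal.Quotient.mk Q).comp (algebraMap D C) :=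
      RingHom.ext hi
    rw [this, ← Polynomial.hom_eval₂, hf0, map_zero]
  have hbij := IsAlgClosed.algebraMap_bijective_of_isIntegral (k := K) (K := C ⧸ Q)
  let e := RingEquiv.ofBijective _ hbij
  refine ⟨e.symm.toRingHom.comp (Ideal.Quotient.mk Q), RingHom.ext fun d => ?_⟩
  change e.symm (Ideal.Quotient.mk Q (algebraMap D C d)) = ψ d
  rw [← hi, RingEquiv.symm_apply_eq]
  rfl

/-- Over a point of an affine integrally closed scheme, every root of the specialization of the
minimal polynomial of an integral element is the value of this element at some point. -/
theorem exists_ringHom_apply_eq_root {A F K : Type*} [CommRing A] [IsDomain A]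
    [IsIntegrallyClosed A] [Field F] [Algebra A F] [FaithfulSMul A F] [Field K] [IsAlgClosed K]
    {ev : A →+* K} (hev : Function.Surjective ev) {θ : F} (hθ : IsIntegral A θ) {ρ : K}
    (hρ : (minpoly A θ).eval₂ ev ρ = 0) :
    ∃ φ : integralClosure A F →+* K, φ.comp (algebraMap A _) = ev ∧ φ ⟨θ, hθ⟩ = ρ := by
  let C := integralClosure A F
  let x : C := ⟨θ, hθ⟩
  have hx : IsIntegral A x := Algebra.IsIntegral.isIntegral x
  have hmin : minpoly A θ = minpoly A x :=
    minpoly.algebraMap_eq (B := C) (B' := F) (FaithfulSMul.algebraMap_injective C F) x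
  rw [hmin] at hρ
  have : Module.IsTorsionFree A C := by
    have : FaithfulSMul A C := by
      rw [faithfulSMul_iff_algebraMap_injective]
      intro a b hab
      exact FaithfulSMul.algebraMap_injective A F (congrArg Subtype.val hab)
    infer_instance
  -- Normality of `A` gives `A[x] ≅ A[X] / (minpoly)`, so any root `ρ` defines a homomorphism on
  -- `A[x]`, which is then extended along the integral extension.
  let ψ : Algebra.adjoin A {x} →+* K :=
    (AdjoinRoot.lift ev ρ hρ).comp (minpoly.equivAdjoin hx).symm.toRingEquiv.toRingHom
  have hψA : ∀ a, ψ (algebraMap A _ a) = ev a := fun a => by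
    simp only [ψ, RingHom.comp_apply]
    have : (minpoly.equivAdjoin hx).symm.toRingEquiv.toRingHom (algebraMap A _ a) =
      algebraMap A _ a := (minpoly.equivAdjoin hx).symm.commutes a
    rw [this]
    exact AdjoinRoot.lift_of hρ
  have hψx : ψ ⟨x, Algebra.self_mem_adjoin_singleton A x⟩ = ρ := by
    have : (minpoly.equivAdjoin hx).symm.toRingEquiv.toRingHom
        ⟨x, Algebra.self_mem_adjoin_singleton A x⟩ = AdjoinRoot.root _ := by
      change (minpoly.equivAdjoin hx).symm ⟨x, Algebra.self_mem_adjoin_singleton A x⟩ = _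
      rw [AlgEquiv.symm_apply_eq, minpoly.coe_equivAdjoin]
      exact (AdjoinRoot.liftAlgHom_root _ _ _ _).symm
    simp only [ψ, RingHom.comp_apply]
    rw [this]
    exact AdjoinRoot.lift_root hρ
  have : Algebra.IsIntegral (Algebra.adjoin A {x}) C := Algebra.IsIntegral.tower_top (R := A)
  obtain ⟨φ, hφ⟩ := RingHom.exists_extension_of_isIntegral (C := C) ψ (fun y => by
    obtain ⟨a, rfl⟩ := hev y
    exact ⟨_, hψA a⟩)
  refine ⟨φ, RingHom.ext fun a => ?_, ?_⟩
  · rw [← hψA a, ← hφ]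
    rfl
  · rw [← hψx, ← hφ]
    rfl

theorem IsFractionRing.exists_map_eq_C_mul {A L : Type*} [CommRing A] [IsDomain A] [Field L]
    [Algebra A L] [IsFractionRing A L] (G : Polynomial L) :
    ∃ a : A, a ≠ 0 ∧ ∃ G' : Polynomial A,
      G'.map (algebraMap A L) = Polynomial.C (algebraMap A L a) * G := by
  obtain ⟨b, hb, h⟩ := IsLocalization.integerNormalization_spec (nonZeroDivisors A) G
  refine ⟨b, nonZeroDivisors.ne_zero hb, _, h.trans ?_⟩
  rw [Algebra.smul_def]
  rfl

/-- Linear independence over the function field of the base specializes to the general fibre of a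
finite separable morphism. -/
theorem exists_forall_fibre_linearIndependent {A L F K ι : Type*} [CommRing A] [IsDomain A]
    [IsIntegrallyClosed A] [Field L] [Field F] [Algebra A L] [Algebra A F] [Algebra L F]
    [IsScalarTower A L F] [IsFractionRing A L] [FiniteDimensional L F] [Algebra.IsSeparable L F]
    [Field K] [IsAlgClosed K] [Fintype ι] {g : ι → integralClosure A F}
    (hg : LinearIndependent L (fun i => (g i : F))) :
    ∃ Δ : A, Δ ≠ 0 ∧ ∀ ev : A →+* K, Function.Surjective ev → ev Δ ≠ 0 → ∀ c : ι → K,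
      (∀ φ : integralClosure A F →+* K, φ.comp (algebraMap A _) = ev →
        ∑ i, c i * φ (g i) = 0) → c = 0 := by
  have hinjA : Function.Injective (algebraMap A L) := IsFractionRing.injective A L
  have : FaithfulSMul A F := by
    rw [faithfulSMul_iff_algebraMap_injective, IsScalarTower.algebraMap_eq A L F]
    exact (algebraMap L F).injective.comp hinjA
  -- a primitive element
  obtain ⟨θ, hθ, hθtop⟩ : ∃ θ : F, IsIntegral A θ ∧ Algebra.adjoin L {θ} = ⊤ := by
    obtain ⟨θ, hθ⟩ := Field.exists_primitive_element L F
    obtain ⟨a, ha, hint⟩ := ((IsFractionRing.isAlgebraic_iff A L F).mpr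
      (Algebra.IsAlgebraic.isAlgebraic (R := L) θ)).exists_integral_multiple
    refine ⟨a • θ, hint, ?_⟩
    have haθ : a • θ = algebraMap L F (algebraMap A L a) * θ := by
      rw [Algebra.smul_def, ← IsScalarTower.algebraMap_apply]
    have ha' : algebraMap L F (algebraMap A L a) ≠ 0 := by
      simpa using (map_ne_zero_iff _ hinjA).mpr ha
    rw [← IntermediateField.adjoin_simple_toSubalgebra_of_isAlgebraic
      (Algebra.IsAlgebraic.isAlgebraic _), ← IntermediateField.top_toSubalgebra, ← hθ]
    congr 1
    apply le_antisymm
    · rw [hθ]; exact le_top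
    · rw [IntermediateField.adjoin_simple_le_iff]
      have : θ = algebraMap L F (algebraMap A L a)⁻¹ * (a • θ) := by
        rw [haθ, map_inv₀, inv_mul_cancel_left₀ ha']
      have h2 := mul_mem (IntermediateField.algebraMap_mem (IntermediateField.adjoin L {a • θ})
        (algebraMap A L a)⁻¹) (IntermediateField.mem_adjoin_simple_self L (a • θ))
      rwa [← this] at h2
  set p := minpoly A θ with hp
  have hpmonic : p.Monic := minpoly.monic hθ
  have hpL : minpoly L θ = p.map (algebraMap A L) := minpoly.isIntegrallyClosed_eq_field_fractions' L hθ
  have hsep : (p.map (algebraMap A L)).Separable := hpL ▸ Algebra.IsSeparable.isSeparable L θ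
  -- the discriminant
  obtain ⟨h, hh0, u, v, huv⟩ : ∃ h : A, h ≠ 0 ∧ ∃ u v : Polynomial A,
      u * p + v * Polynomial.derivative p = Polynomial.C h := by
    obtain ⟨u, v, huv⟩ := hsep
    obtain ⟨a, ha, u', hu'⟩ := IsFractionRing.exists_map_eq_C_mul (A := A) u
    obtain ⟨b, hb, v', hv'⟩ := IsFractionRing.exists_map_eq_C_mul (A := A) v
    refine ⟨a * b, mul_ne_zero ha hb, Polynomial.C b * u', Polynomial.C a * v', ?_⟩
    apply Polynomial.map_injective _ hinjA
    rw [Polynomial.derivative_map] at huv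
    simp only [Polynomial.map_add, Polynomial.map_mul, Polynomial.map_C, hu', hv', map_mul]
    linear_combination (Polynomial.C (algebraMap A L a) * Polynomial.C (algebraMap A L b)) * huv
  -- expansions in powers of the primitive element
  have hG : ∀ i, ∃ G : Polynomial L, Polynomial.aeval θ G = (g i : F) ∧
      G.degree < p.degree := by
    intro i
    have hmem : (g i : F) ∈ Algebra.adjoin L {θ} := hθtop ▸ Algebra.mem_top
    rw [Algebra.adjoin_singleton_eq_range_aeval] at hmem
    obtain ⟨G, hG⟩ := hmem
    refine ⟨G %ₘ (minpoly L θ), ?_, ?_⟩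
    · rw [← hG]
      conv_rhs => rw [← Polynomial.modByMonic_add_div G (minpoly L θ)]
      simp
    · rw [← Polynomial.degree_map_eq_of_injective hinjA p, ← hpL]
      exact Polynomial.degree_modByMonic_lt _ (minpoly.monic (hθ.tower_top))
  choose G hGg hGdeg using hG
  have hG' : ∀ i, ∃ a : A, a ≠ 0 ∧ ∃ G' : Polynomial A,
      G'.map (algebraMap A L) = Polynomial.C (algebraMap A L a) * G i :=
    fun i => IsFractionRing.exists_map_eq_C_mul (G i)
  choose f hf0 G' hG' using hG'
  have hf0' : ∀ i, algebraMap A L (f i) ≠ 0 := fun i => (map_ne_zero_iff _ hinjA).mpr (hf0 i)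
  have hG'deg : ∀ i, (G' i).degree < p.degree := by
    intro i
    rw [← Polynomial.degree_map_eq_of_injective hinjA (G' i), hG',
      Polynomial.degree_C_mul (hf0' i)]
    exact hGdeg i
  have hG'θ : ∀ i, Polynomial.aeval (⟨θ, hθ⟩ : integralClosure A F) (G' i) =
      algebraMap A _ (f i) * g i := by
    intro i
    apply Subtype.ext
    have h1 : ((Polynomial.aeval (⟨θ, hθ⟩ : integralClosure A F) (G' i) : integralClosure A F) : F) =
        Polynomial.aeval θ (G' i) :=
      (Polynomial.aeval_algebraMap_apply F (⟨θ, hθ⟩ : integralClosure A F) (G' i)).symm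
    rw [h1, ← Polynomial.aeval_map_algebraMap L, hG', map_mul, hGg, Polynomial.aeval_C,
      ← IsScalarTower.algebraMap_apply]
    rfl
  -- a right inverse of the coefficient matrix
  let N := p.natDegree
  let T : (ι → L) →ₗ[L] (Fin N → L) := Fintype.linearCombination L
    (fun i (j : Fin N) => algebraMap A L ((G' i).coeff j))
  -- A relation between the rows of coefficients of the `G' i` becomes, at `θ`, a relation between
  -- the `g i` over `L`.
  have hT : LinearMap.ker T = ⊥ := by
    rw [LinearMap.ker_eq_bot']
    intro l hl
    have hsum : ∑ i, Polynomial.C (l i) * (G' i).map (algebraMap A L) = 0 := by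
      ext j
      rw [Polynomial.finsetSum_coeff, Polynomial.coeff_zero]
      by_cases hj : j < N
      · have := congrFun hl ⟨j, hj⟩
        simp only [T, Fintype.linearCombination_apply, Finset.sum_apply, Pi.smul_apply,
          smul_eq_mul, Pi.zero_apply] at this
        simpa only [Polynomial.coeff_C_mul, Polynomial.coeff_map] using this
      · refine Finset.sum_eq_zero fun i _ => ?_
        rw [Polynomial.coeff_C_mul, Polynomial.coeff_map,
          Polynomial.coeff_eq_zero_of_degree_lt, map_zero, mul_zero]
        refine (hG'deg i).trans_le ?_
        rw [Polynomial.degree_eq_natDegree hpmonic.ne_zero]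
        exact_mod_cast not_lt.mp hj
    have h2 := congrArg (Polynomial.aeval θ) hsum
    rw [Fintype.linearIndependent_iff] at hg
    have h3 := hg (fun i => l i * algebraMap A L (f i)) (by
      rw [map_zero, map_sum] at h2
      rw [← h2]
      refine Finset.sum_congr rfl fun i _ => ?_
      rw [hG', map_mul, map_mul, Polynomial.aeval_C, Polynomial.aeval_C, hGg, Algebra.smul_def,
        map_mul, mul_assoc])
    ext i
    exact (mul_eq_zero.mp (h3 i)).resolve_right (hf0' i)
  obtain ⟨T', hT'⟩ := LinearMap.exists_leftInverse_of_injective T hT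
  classical
  obtain ⟨b, hb⟩ := IsLocalization.exist_integer_multiples_of_finite (nonZeroDivisors A)
    (fun jl : Fin N × ι => T' (Pi.single jl.1 1) jl.2)
  choose β hβ using hb
  have hβα : ∀ i l, ∑ j : Fin N, (G' i).coeff j * β (j, l) = if i = l then (b : A) else 0 := by
    intro i l
    apply hinjA
    have h1 := congrFun (LinearMap.congr_fun hT' (Pi.single i 1)) l
    rw [LinearMap.comp_apply, LinearMap.id_apply] at h1
    have h2 : T (Pi.single i 1) = ∑ j : Fin N, algebraMap A L ((G' i).coeff j) • Pi.single j 1 := by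
      simp only [T, Fintype.linearCombination_apply_single, one_smul]
      ext j
      simp [Finset.sum_apply, Pi.single_apply, Algebra.smul_def]
    rw [h2, map_sum, Finset.sum_apply] at h1
    simp only [map_smul, Pi.smul_apply, smul_eq_mul] at h1
    rw [map_sum]
    simp only [map_mul, hβ, Algebra.smul_def]
    rw [Finset.sum_congr rfl fun j _ => mul_left_comm _ _ _, ← Finset.mul_sum, h1, Pi.single_apply]
    by_cases hil : i = l
    · simp [hil]
    · simp [hil, Ne.symm hil]
  -- The three factors keep, respectively, the roots of the specialized `p` distinct, the
  -- coefficient matrix of maximal rank, and the denominators of the `g i` invertible.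
  refine ⟨h * b * ∏ i, f i, mul_ne_zero (mul_ne_zero hh0 (nonZeroDivisors.ne_zero b.2))
    (Finset.prod_ne_zero_iff.mpr fun i _ => hf0 i), fun ev hev hΔ c hc => ?_⟩
  rw [map_mul, map_mul, map_prod] at hΔ
  have hevh : ev h ≠ 0 := left_ne_zero_of_mul (left_ne_zero_of_mul hΔ)
  have hevb : ev b ≠ 0 := right_ne_zero_of_mul (left_ne_zero_of_mul hΔ)
  have hevf : ∀ i, ev (f i) ≠ 0 := fun i =>
    Finset.prod_ne_zero_iff.mp (right_ne_zero_of_mul hΔ) i (Finset.mem_univ i)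
  have hsep' : (p.map ev).Separable := by
    have h1 := congrArg (Polynomial.map ev) huv
    rw [Polynomial.map_add, Polynomial.map_mul, Polynomial.map_mul, Polynomial.map_C,
      ← Polynomial.derivative_map] at h1
    refine ⟨Polynomial.C (ev h)⁻¹ * u.map ev, Polynomial.C (ev h)⁻¹ * v.map ev, ?_⟩
    rw [mul_assoc, mul_assoc, ← mul_add, h1, ← Polynomial.C_mul, inv_mul_cancel₀ hevh,
      Polynomial.C_1]
  let q : Polynomial K := ∑ i, Polynomial.C (c i / ev (f i)) * (G' i).map ev
  have hN : (p.map ev).natDegree = N := hpmonic.natDegree_map ev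
  have hpK : p.map ev ≠ 0 := (hpmonic.map ev).ne_zero
  have hqdeg : q.degree < (p.map ev).degree := by
    rw [hpmonic.degree_map ev]
    refine (Polynomial.degree_sum_le _ _).trans_lt ?_
    rw [Finset.sup_lt_iff (bot_lt_iff_ne_bot.mpr (Polynomial.degree_ne_bot.mpr hpmonic.ne_zero))]
    intro i _
    rw [← Polynomial.smul_eq_C_mul]
    refine (Polynomial.degree_smul_le _ _).trans_lt ?_
    exact Polynomial.degree_map_le.trans_lt (hG'deg i)
  -- Each of the `N` distinct roots of `p.map ev` is the value of `θ` at some `φ` over `ev`, where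
  -- `q` takes the value `∑ i, c i * φ (g i) = 0`; but `q` has degree less than `N`.
  have hq0 : q = 0 := by
    by_contra hq0
    have hcard : (p.map ev).roots.toFinset.card = (p.map ev).natDegree := by
      rw [Multiset.toFinset_card_of_nodup (Polynomial.nodup_roots hsep'),
        (IsAlgClosed.splits (p.map ev)).natDegree_eq_card_roots]
    refine hq0 (Polynomial.eq_zero_of_natDegree_lt_card_of_eval_eq_zero' q
      (p.map ev).roots.toFinset (fun ρ hρ => ?_) ?_)
    · rw [Multiset.mem_toFinset, Polynomial.mem_roots hpK, Polynomial.IsRoot.def,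
        Polynomial.eval_map] at hρ
      obtain ⟨φ, hφA, hφθ⟩ := exists_ringHom_apply_eq_root hev hθ hρ
      rw [← hc φ hφA, Polynomial.eval_finsetSum]
      refine Finset.sum_congr rfl fun i _ => ?_
      have h1 := congrArg φ (hG'θ i)
      rw [Polynomial.aeval_def, Polynomial.hom_eval₂, hφA, hφθ, map_mul,
        ← RingHom.comp_apply, hφA] at h1
      rw [Polynomial.eval_mul, Polynomial.eval_C, Polynomial.eval_map, h1]
      field_simp [hevf i]
    · rw [hcard]
      exact Polynomial.natDegree_lt_natDegree hq0 hqdeg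
  have hcoeff : ∀ j, ∑ i, c i / ev (f i) * ev ((G' i).coeff j) = 0 := by
    intro j
    have := congrArg (fun r => Polynomial.coeff r j) hq0
    simpa [q, Polynomial.finsetSum_coeff] using this
  ext l
  have h1 : ∑ j : Fin N, (∑ i, c i / ev (f i) * ev ((G' i).coeff j)) * ev (β (j, l)) = 0 :=
    Finset.sum_eq_zero fun j _ => by rw [hcoeff, zero_mul]
  simp only [Finset.sum_mul] at h1
  rw [Finset.sum_comm] at h1
  have h2 : ∀ i, ∑ j : Fin N, c i / ev (f i) * ev ((G' i).coeff j) * ev (β (j, l)) =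
      if i = l then c i / ev (f i) * ev b else 0 := by
    intro i
    have h3 := congrArg ev (hβα i l)
    rw [map_sum] at h3
    simp only [map_mul] at h3
    simp only [mul_assoc, ← Finset.mul_sum, h3]
    by_cases hil : i = l <;> simp [hil]
  simp only [h2, Finset.sum_ite_eq', Finset.mem_univ, if_true] at h1
  have h4 := (mul_eq_zero.mp h1).resolve_right hevb
  exact (div_eq_zero_iff.mp h4).resolve_right (hevf l)

/-! ### Cones, affine charts and their vanishing ideals. -/

/-- The linear polynomial attached to a linear form on `K ^ σ`. -/
noncomputable def MvPolynomial.linForm {K σ : Type*} [Field K] [Fintype σ] [DecidableEq σ] :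
    Module.Dual K (σ → K) →ₗ[K] MvPolynomial σ K where
  toFun φ := ∑ i, φ (Pi.single i 1) • MvPolynomial.X i
  map_add' φ ψ := by simp [add_smul, Finset.sum_add_distrib]
  map_smul' a φ := by simp [mul_smul, Finset.smul_sum]

theorem MvPolynomial.linForm_apply {K σ : Type*} [Field K] [Fintype σ] [DecidableEq σ]
    (φ : Module.Dual K (σ → K)) :
    MvPolynomial.linForm φ = ∑ i, φ (Pi.single i 1) • MvPolynomial.X i := rfl

@[simp]
theorem MvPolynomial.eval_linForm {K σ : Type*} [Field K] [Fintype σ] [DecidableEq σ]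
    (φ : Module.Dual K (σ → K)) (v : σ → K) :
    MvPolynomial.eval v (MvPolynomial.linForm φ) = φ v := by
  conv_rhs => rw [pi_eq_sum_univ' v, map_sum]
  simp [MvPolynomial.linForm_apply, MvPolynomial.smul_eval, mul_comm]

theorem MvPolynomial.isHomogeneous_linForm {K σ : Type*} [Field K] [Fintype σ] [DecidableEq σ]
    (φ : Module.Dual K (σ → K)) : (MvPolynomial.linForm φ).IsHomogeneous 1 := by
  rw [MvPolynomial.linForm_apply]
  refine MvPolynomial.IsHomogeneous.sum _ _ _ fun i _ => ?_
  rw [MvPolynomial.smul_eq_C_mul]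
  exact MvPolynomial.isHomogeneous_C_mul_X _ _

/-- The homogenization of a polynomial with respect to a linear polynomial. -/
noncomputable def MvPolynomial.homogenizeAt {K σ : Type*} [Field K] (l f : MvPolynomial σ K) :
    MvPolynomial σ K :=
  ∑ d ∈ Finset.range (f.totalDegree + 1), l ^ (f.totalDegree - d) * homogeneousComponent d f

theorem MvPolynomial.isHomogeneous_homogenizeAt {K σ : Type*} [Field K] {l : MvPolynomial σ K}
    (hl : l.IsHomogeneous 1) (f : MvPolynomial σ K) :
    (homogenizeAt l f).IsHomogeneous f.totalDegree := by
  refine MvPolynomial.IsHomogeneous.sum _ _ _ fun d hd => ?_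
  have h := (hl.pow (f.totalDegree - d)).mul (homogeneousComponent_isHomogeneous d f)
  rwa [one_mul, Nat.sub_add_cancel (Nat.lt_succ_iff.mp (Finset.mem_range.mp hd))] at h

theorem MvPolynomial.eval_homogenizeAt {K σ : Type*} [Field K] {l : MvPolynomial σ K}
    (f : MvPolynomial σ K) {v : σ → K} (hv : eval v l = 1) :
    eval v (homogenizeAt l f) = eval v f := by
  conv_rhs => rw [← sum_homogeneousComponent f]
  simp [homogenizeAt, hv, map_sum]

/-- The punctured affine cone over a subset of projective space. -/
def projCone {K : Type*} [Field K] {n : ℕ} (Z : Set (PSpace K n)) : Set (Fin (n + 1) → K) :=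
  {v | ∃ hv : v ≠ 0, Projectivization.mk K v hv ∈ Z}

theorem smul_mem_projCone {K : Type*} [Field K] {n : ℕ} {Z : Set (PSpace K n)}
    {v : Fin (n + 1) → K} (hv : v ∈ projCone Z) {a : K} (ha : a ≠ 0) : a • v ∈ projCone Z := by
  obtain ⟨hv0, hv⟩ := hv
  refine ⟨smul_ne_zero ha hv0, ?_⟩
  rwa [(Projectivization.mk_eq_mk_iff' K (a • v) v (smul_ne_zero ha hv0) hv0).mpr ⟨a, rfl⟩]

theorem projCone_mono {K : Type*} [Field K] {n : ℕ} {Z Z' : Set (PSpace K n)} (h : Z ⊆ Z') :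
    projCone Z ⊆ projCone Z' := fun _ ⟨hv, hz⟩ => ⟨hv, h hz⟩

theorem rep_mem_projCone {K : Type*} [Field K] {n : ℕ} {Z : Set (PSpace K n)} {p : PSpace K n} :
    p.rep ∈ projCone Z ↔ p ∈ Z := by
  refine ⟨fun ⟨h, hp⟩ => by rwa [Projectivization.mk_rep] at hp, fun hp => ⟨p.rep_nonzero, ?_⟩⟩
  rwa [Projectivization.mk_rep]

theorem IsClosed.exists_mem_projCone_iff {K : Type*} [Field K] {n : ℕ} {Z : Set (PSpace K n)}
    (hZ : IsClosed Z) : ∃ T : Set (MvPolynomial (Fin (n + 1)) K),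
      (∀ f ∈ T, ∃ d : ℕ, f.IsHomogeneous d) ∧
      ∀ v, v ≠ 0 → (v ∈ projCone Z ↔ ∀ f ∈ T, MvPolynomial.eval v f = 0) := by
  obtain ⟨T, hT, rfl⟩ := (isClosed_iff_isProjAlgebraic Z).mp hZ
  refine ⟨T, hT, fun v hv => ?_⟩
  have h : v ∈ projCone (projZeroLocus T) ↔
      ∀ f ∈ T, MvPolynomial.eval (Projectivization.mk K v hv).rep f = 0 :=
    ⟨fun ⟨_, h⟩ => h, fun h => ⟨hv, h⟩⟩
  rw [h]
  refine forall₂_congr fun f hf => ?_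
  obtain ⟨d, hd⟩ := hT f hf
  exact eval_rep_mk_eq_zero_iff hd v hv

theorem IsIrreducible.exists_projCone_eval_ne_zero {K : Type*} [Field K] {n : ℕ}
    {Z : Set (PSpace K n)} (hZ : IsIrreducible Z) {f g : MvPolynomial (Fin (n + 1)) K} {d e : ℕ}
    (hf : f.IsHomogeneous d) (hg : g.IsHomogeneous e) {v w : Fin (n + 1) → K}
    (hv : v ∈ projCone Z) (hw : w ∈ projCone Z) (hfv : MvPolynomial.eval v f ≠ 0)
    (hgw : MvPolynomial.eval w g ≠ 0) :
    ∃ u ∈ projCone Z, MvPolynomial.eval u f ≠ 0 ∧ MvPolynomial.eval u g ≠ 0 := by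
  have hopen : ∀ {h : MvPolynomial (Fin (n + 1)) K} {c : ℕ}, h.IsHomogeneous c →
      IsOpen {p : PSpace K n | MvPolynomial.eval p.rep h ≠ 0} := by
    intro h c hc
    rw [← isClosed_compl_iff, isClosed_iff_isProjAlgebraic]
    refine ⟨{h}, by rintro _ rfl; exact ⟨c, hc⟩, ?_⟩
    ext p
    simp [projZeroLocus]
  obtain ⟨hv0, hv⟩ := hv
  obtain ⟨hw0, hw⟩ := hw
  obtain ⟨p, hpZ, hpf, hpg⟩ := hZ.2 _ _ (hopen hf) (hopen hg)
    ⟨_, hv, (eval_rep_mk_eq_zero_iff hf v hv0).not.mpr hfv⟩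
    ⟨_, hw, (eval_rep_mk_eq_zero_iff hg w hw0).not.mpr hgw⟩
  exact ⟨p.rep, rep_mem_projCone.mpr hpZ, hpf, hpg⟩

/-- The points of the punctured cone over `Z` at which a linear form takes the value `1`; this is
an affine chart of `Z`. -/
def affinePart {K : Type*} [Field K] {n : ℕ} (η : Module.Dual K (Fin (n + 1) → K))
    (Z : Set (PSpace K n)) : Set (Fin (n + 1) → K) :=
  {v | η v = 1 ∧ v ∈ projCone Z}

theorem smul_inv_mem_affinePart {K : Type*} [Field K] {n : ℕ}
    {η : Module.Dual K (Fin (n + 1) → K)} {Z : Set (PSpace K n)} {v : Fin (n + 1) → K}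
    (hv : v ∈ projCone Z) (hη : η v ≠ 0) : (η v)⁻¹ • v ∈ affinePart η Z :=
  ⟨by simp [hη], smul_mem_projCone hv (inv_ne_zero hη)⟩

theorem MvPolynomial.IsHomogeneous.eval_smul_eq {K σ : Type*} [Field K] {f : MvPolynomial σ K}
    {d : ℕ} (hf : f.IsHomogeneous d) (a : K) (v : σ → K) :
    eval (a • v) f = a ^ d * eval v f := by
  rw [eval_eq, eval_eq, Finset.mul_sum]
  refine Finset.sum_congr rfl fun s hs => ?_
  have hdeg : ∑ i ∈ s.support, s i = d := by
    have h1 := hf (mem_support_iff.mp hs)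
    simpa [Finsupp.weight_apply, Finsupp.sum] using h1
  simp only [Pi.smul_apply, smul_eq_mul, mul_pow, Finset.prod_mul_distrib]
  rw [Finset.prod_pow_eq_pow_sum, hdeg]
  ring

theorem IsIrreducible.exists_affinePart_eval_ne_zero {K : Type*} [Field K] {n : ℕ}
    {Z : Set (PSpace K n)} (hZ : IsIrreducible Z) {η : Module.Dual K (Fin (n + 1) → K)}
    {f : MvPolynomial (Fin (n + 1)) K} {d : ℕ} (hf : f.IsHomogeneous d) {v w : Fin (n + 1) → K}
    (hv : v ∈ projCone Z) (hfv : MvPolynomial.eval v f ≠ 0) (hw : w ∈ projCone Z)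
    (hηw : η w ≠ 0) : ∃ u ∈ affinePart η Z, MvPolynomial.eval u f ≠ 0 := by
  obtain ⟨u, hu, huf, huη⟩ := hZ.exists_projCone_eval_ne_zero hf
    (MvPolynomial.isHomogeneous_linForm η) hv hw hfv (by rwa [MvPolynomial.eval_linForm])
  rw [MvPolynomial.eval_linForm] at huη
  refine ⟨_, smul_inv_mem_affinePart hu huη, ?_⟩
  rw [hf.eval_smul_eq]
  exact mul_ne_zero (pow_ne_zero _ (inv_ne_zero huη)) huf

/-- Homogenizing by `η` makes two functions nonvanishing on the chart into forms nonvanishing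
somewhere on the cone; irreducibility gives a common point. -/
theorem IsIrreducible.isPrime_vanishingIdeal_affinePart {K : Type*} [Field K] {n : ℕ}
    {Z : Set (PSpace K n)} (hZ : IsIrreducible Z) {η : Module.Dual K (Fin (n + 1) → K)}
    (hη : (affinePart η Z).Nonempty) :
    (MvPolynomial.vanishingIdeal K (affinePart η Z)).IsPrime := by
  refine ⟨fun h => ?_, fun {f g} hfg => ?_⟩
  · obtain ⟨v, hv⟩ := hη
    have := (Ideal.eq_top_iff_one _).mp h v hv
    simp at this
  · simp only [MvPolynomial.mem_vanishingIdeal_iff, MvPolynomial.aeval_eq_eval] at hfg ⊢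
    by_contra! hcon
    obtain ⟨⟨v, hv, hfv⟩, w, hw, hgw⟩ := hcon
    let l := MvPolynomial.linForm η
    have hl := MvPolynomial.isHomogeneous_linForm η
    have hl1 : ∀ u ∈ affinePart η Z, MvPolynomial.eval u l = 1 := fun u hu => by
      rw [MvPolynomial.eval_linForm, hu.1]
    have hF := MvPolynomial.isHomogeneous_homogenizeAt hl f
    have hG := MvPolynomial.isHomogeneous_homogenizeAt hl g
    -- The extra factor `l` forces the common point to satisfy `η u ≠ 0`, so that it can be rescaled
    -- into the chart.
    have hfv' : MvPolynomial.eval v (l * MvPolynomial.homogenizeAt l f) ≠ 0 := by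
      rwa [map_mul, MvPolynomial.eval_homogenizeAt f (hl1 v hv), hl1 v hv, one_mul]
    have hgw' : MvPolynomial.eval w (MvPolynomial.homogenizeAt l g) ≠ 0 := by
      rwa [MvPolynomial.eval_homogenizeAt g (hl1 w hw)]
    obtain ⟨u, hu, huf, hug⟩ :=
      hZ.exists_projCone_eval_ne_zero (hl.mul hF) hG hv.2 hw.2 hfv' hgw'
    rw [map_mul, MvPolynomial.eval_linForm] at huf
    have hη0 := left_ne_zero_of_mul huf
    have hu' := smul_inv_mem_affinePart hu hη0
    have h1 := hfg _ hu'
    rw [map_mul, ← MvPolynomial.eval_homogenizeAt f (hl1 _ hu'),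
      ← MvPolynomial.eval_homogenizeAt g (hl1 _ hu'), hF.eval_smul_eq, hG.eval_smul_eq] at h1
    have hinv := inv_ne_zero hη0
    exact mul_ne_zero (mul_ne_zero (pow_ne_zero _ hinv) (right_ne_zero_of_mul huf))
      (mul_ne_zero (pow_ne_zero _ hinv) hug) h1

/-- An equation of `Z` not vanishing identically on `Z'` is nonzero somewhere on the chart of `Z'`,
since nonempty open subsets of an irreducible set meet. -/
theorem vanishingIdeal_affinePart_lt {K : Type*} [Field K] {n : ℕ} {Z Z' : Set (PSpace K n)}
    (hZ : IsClosed Z) (hZ' : IsIrreducible Z') (h : Z ⊂ Z')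
    {η : Module.Dual K (Fin (n + 1) → K)} (hη : (affinePart η Z).Nonempty) :
    MvPolynomial.vanishingIdeal K (affinePart η Z') <
      MvPolynomial.vanishingIdeal K (affinePart η Z) := by
  refine lt_of_le_not_ge (MvPolynomial.vanishingIdeal_anti_mono fun v hv =>
    ⟨hv.1, projCone_mono h.1 hv.2⟩) fun hle => ?_
  obtain ⟨p, hpZ', hpZ⟩ := Set.exists_of_ssubset h
  obtain ⟨T, hT, hTZ⟩ := hZ.exists_mem_projCone_iff
  have hp := rep_mem_projCone.not.mpr hpZ
  rw [hTZ _ p.rep_nonzero] at hp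
  push Not at hp
  obtain ⟨f, hfT, hfp⟩ := hp
  obtain ⟨d, hd⟩ := hT f hfT
  obtain ⟨w, hw⟩ := hη
  obtain ⟨u, hu, huf⟩ := hZ'.exists_affinePart_eval_ne_zero (η := η) hd
    (rep_mem_projCone.mpr hpZ') hfp (projCone_mono h.1 hw.2) (by rw [hw.1]; exact one_ne_zero)
  refine huf ?_
  have hfZ : f ∈ MvPolynomial.vanishingIdeal K (affinePart η Z) := fun x hx => by
    rw [MvPolynomial.aeval_eq_eval]
    exact (hTZ x hx.2.1).mp hx.2 f hfT
  have := hle hfZ u hu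
  rwa [MvPolynomial.aeval_eq_eval] at this

/-- The chart is cut out in affine space by `η = 1` and the equations of `Z`. This is what turns a
homomorphism killing the ideal into a point of `Z`. -/
theorem zeroLocus_vanishingIdeal_affinePart {K : Type*} [Field K] {n : ℕ}
    {Z : Set (PSpace K n)} (hZ : IsClosed Z) (η : Module.Dual K (Fin (n + 1) → K)) :
    MvPolynomial.zeroLocus K (MvPolynomial.vanishingIdeal K (affinePart η Z)) =
      affinePart η Z := by
  refine subset_antisymm (fun v hv => ?_) (MvPolynomial.zeroLocus_vanishingIdeal_le _)
  obtain ⟨T, hT, hTZ⟩ := hZ.exists_mem_projCone_iff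
  rw [MvPolynomial.mem_zeroLocus_iff] at hv
  have h1 : η v = 1 := by
    have := hv (MvPolynomial.linForm η - 1) fun x hx => by
      rw [MvPolynomial.aeval_eq_eval, map_sub, MvPolynomial.eval_linForm, hx.1, map_one, sub_self]
    rwa [MvPolynomial.aeval_eq_eval, map_sub, MvPolynomial.eval_linForm, map_one,
      sub_eq_zero] at this
  have hv0 : v ≠ 0 := by
    rintro rfl
    simp at h1
  refine ⟨h1, (hTZ v hv0).mpr fun f hf => ?_⟩
  rw [← MvPolynomial.aeval_eq_eval]
  refine hv f fun x hx => ?_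
  rw [MvPolynomial.aeval_eq_eval]
  exact (hTZ x hx.2.1).mp hx.2 f hf

/-! ### Finiteness of a projection whose centre misses the variety. -/

theorem MvPolynomial.homogeneousComponent_add_mul_of_isHomogeneous {R σ : Type*} [CommSemiring R]
    {f : MvPolynomial σ R} {d : ℕ} (hf : f.IsHomogeneous d) (n : ℕ) (q : MvPolynomial σ R) :
    homogeneousComponent (n + d) (q * f) = homogeneousComponent n q * f := by
  conv_lhs => rw [← sum_homogeneousComponent q, Finset.sum_mul, map_sum]
  have h : ∀ i, homogeneousComponent (n + d) (homogeneousComponent i q * f) =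
      if n = i then homogeneousComponent i q * f else 0 := by
    intro i
    rw [homogeneousComponent_of_mem
      ((mem_homogeneousSubmodule _ _).mpr ((homogeneousComponent_isHomogeneous i q).mul hf))]
    simp
  simp only [h, Finset.sum_ite_eq, Finset.mem_range]
  split_ifs with hn
  · rfl
  · rw [homogeneousComponent_eq_zero n q (by lia), zero_mul]

theorem MvPolynomial.homogeneousComponent_mul_of_isHomogeneous_of_lt {R σ : Type*}
    [CommSemiring R] {f : MvPolynomial σ R} {d : ℕ} (hf : f.IsHomogeneous d) {n : ℕ} (hn : n < d)
    (q : MvPolynomial σ R) : homogeneousComponent n (q * f) = 0 := by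
  conv_lhs => rw [← sum_homogeneousComponent q, Finset.sum_mul, map_sum]
  refine Finset.sum_eq_zero fun i _ => ?_
  rw [homogeneousComponent_of_mem
    ((mem_homogeneousSubmodule _ _).mpr ((homogeneousComponent_isHomogeneous i q).mul hf)),
    if_neg (by lia)]

theorem MvPolynomial.map_homogeneousSubmodule_eq_pow {K F σ : Type*} [Field K] [CommRing F]
    [Algebra K F] (χ : MvPolynomial σ K →ₐ[K] F) (D : ℕ) :
    (homogeneousSubmodule σ K D).map χ.toLinearMap =
      Submodule.span K (Set.range fun i => χ (X i)) ^ D := by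
  rw [← homogeneousSubmodule_one_pow, Submodule.map_pow, homogeneousSubmodule_one_eq_span_X,
    Submodule.map_span, ← Set.range_comp]
  rfl

/-- If the homogeneous polynomials in `T` and the linear forms in `Φ` have no nontrivial common
zero, then modulo `T` every form of large degree is in the ideal generated by `Φ`. -/
theorem MvPolynomial.exists_span_pow_succ_le {K F σ : Type*} [Field K] [IsAlgClosed K]
    [Fintype σ] [DecidableEq σ] [CommRing F] [Algebra K F] {T : Set (MvPolynomial σ K)}
    (hT : ∀ f ∈ T, ∃ d : ℕ, f.IsHomogeneous d) {Φ : Set (Module.Dual K (σ → K))}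
    (h0 : ∀ v, (∀ f ∈ T, eval v f = 0) → (∀ φ ∈ Φ, φ v = 0) → v = 0)
    (χ : MvPolynomial σ K →ₐ[K] F) (hχ : ∀ f ∈ T, χ f = 0) :
    ∃ D : ℕ, Submodule.span K (Set.range fun i => χ (X i)) ^ (D + 1) ≤
      Submodule.span K ((fun φ => χ (linForm φ)) '' Φ) *
        Submodule.span K (Set.range fun i => χ (X i)) ^ D := by
  let I : Ideal (MvPolynomial σ K) := Ideal.span (T ∪ linForm '' Φ)
  -- Nullstellensatz: the origin is the only possible common zero, so a power of the irrelevant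
  -- ideal lies in `I`.
  have hrad : idealOfVars σ K ≤ I.radical := by
    rw [← vanishingIdeal_zeroLocus_eq_radical (K := K), Ideal.span_le]
    rintro _ ⟨i, rfl⟩ v hv
    have hv0 : v = 0 := by
      rw [zeroLocus_span] at hv
      refine h0 v (fun f hf => ?_) fun φ hφ => ?_
      · rw [← aeval_eq_eval]
        exact hv f (Or.inl hf)
      · rw [← eval_linForm, ← aeval_eq_eval]
        exact hv _ (Or.inr ⟨φ, hφ, rfl⟩)
    simp [hv0]
  obtain ⟨D, hD⟩ := Ideal.exists_pow_le_of_le_radical_of_fg hrad (idealOfVars_fg σ K)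
  refine ⟨D, ?_⟩
  have key : ∀ p ∈ I, ∀ q, χ (homogeneousComponent (D + 1) (q * p)) ∈
      Submodule.span K ((fun φ => χ (linForm φ)) '' Φ) *
        Submodule.span K (Set.range fun i => χ (X i)) ^ D := by
    intro p hp
    induction hp using Submodule.span_induction with
    | mem f hf =>
      intro q
      rcases hf with hf | ⟨φ, hφ, rfl⟩
      · obtain ⟨d, hd⟩ := hT f hf
        rcases lt_or_ge (D + 1) d with hlt | hle
        · rw [homogeneousComponent_mul_of_isHomogeneous_of_lt hd hlt, map_zero]
          exact zero_mem _
        · obtain ⟨n, hn⟩ := Nat.exists_eq_add_of_le' hle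
          rw [hn, homogeneousComponent_add_mul_of_isHomogeneous hd, map_mul, hχ f hf, mul_zero]
          exact zero_mem _
      · rw [homogeneousComponent_add_mul_of_isHomogeneous (isHomogeneous_linForm φ), map_mul,
          mul_comm (χ _)]
        refine Submodule.mul_mem_mul
          (Submodule.subset_span (Set.mem_image_of_mem (fun φ => χ (linForm φ)) hφ)) ?_
        rw [← map_homogeneousSubmodule_eq_pow]
        exact ⟨_, homogeneousComponent_isHomogeneous D q, rfl⟩
    | zero => simp
    | add x y _ _ hx hy =>
      intro q
      rw [mul_add, map_add, map_add]
      exact add_mem (hx q) (hy q)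
    | smul a x _ hx =>
      intro q
      rw [smul_eq_mul, ← mul_assoc]
      exact hx _
  rw [← map_homogeneousSubmodule_eq_pow]
  rintro _ ⟨p, hp, rfl⟩
  have hpI : p ∈ I := hD <| (mem_pow_idealOfVars_iff D p).mpr fun x hx => by
    have h1 := (mem_homogeneousSubmodule _ _).mp hp
    rw [Finsupp.degree_apply, ← h1.degree_eq_sum_deg_support hx]
    exact Nat.le_succ D
  have h1 := key p hpI 1
  rwa [one_mul, homogeneousComponent_of_mem hp, if_pos rfl] at h1

/-- Determinant trick: multiplication by `w / l` maps the finitely generated `A`-module spanned by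
`U ^ D` into itself, because `w * U ^ D` lies in `E * U ^ D` and `E / l` lies in `A`. -/
theorem IsIntegral.div_of_pow_succ_le {K A F : Type*} [Field K] [CommRing A] [Field F]
    [Algebra K A] [Algebra A F] [Algebra K F] [IsScalarTower K A F] {U E : Submodule K F}
    (hU : U.FG) {D : ℕ} (hUE : U ^ (D + 1) ≤ E * U ^ D) {l : F}
    (hE : ∀ e ∈ E, e / l ∈ (algebraMap A F).range) {w : F} (hw : w ∈ U) :
    IsIntegral A (w / l) := by
  rcases eq_or_ne w 0 with rfl | hw0
  · rw [zero_div]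
    exact isIntegral_zero
  let N : Submodule A F := Submodule.span A ((U ^ D : Submodule K F) : Set F)
  refine isIntegral_of_smul_mem_submodule N ?_ ?_ _ ?_
  · rw [Submodule.ne_bot_iff]
    exact ⟨w ^ D, Submodule.subset_span (Submodule.pow_mem_pow U hw D), pow_ne_zero _ hw0⟩
  · obtain ⟨s, hs⟩ := hU.pow D
    refine ⟨s, le_antisymm (Submodule.span_mono ?_) (Submodule.span_le.mpr ?_)⟩
    · rw [← hs]
      exact Submodule.subset_span
    · rw [← hs]
      exact Submodule.span_subset_span K A _
  · intro x hx
    induction hx using Submodule.span_induction with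
    | mem x hx =>
      have h1 : w * x ∈ E * U ^ D := hUE (by
        rw [pow_succ']
        exact Submodule.mul_mem_mul hw hx)
      have h2 : ∀ y ∈ E * U ^ D, y / l ∈ N := by
        intro y hy
        induction hy using Submodule.mul_induction_on' with
        | mem_mul_mem e he u hu =>
          obtain ⟨a, ha⟩ := hE e he
          have h3 : e * u / l = a • u := by
            rw [Algebra.smul_def, ha, mul_div_right_comm]
          rw [h3]
          exact Submodule.smul_mem _ _ (Submodule.subset_span hu)
        | add a _ b _ ha hb =>
          rw [add_div]
          exact add_mem ha hb
      have h4 := h2 _ h1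
      rwa [smul_eq_mul, div_mul_eq_mul_div]
    | zero => simp
    | add x y _ _ hx hy =>
      rw [smul_add]
      exact add_mem hx hy
    | smul a x _ hx =>
      rw [smul_comm]
      exact Submodule.smul_mem _ _ hx

theorem IsClosed.exists_span_pow_succ_le {K F ι : Type*} [Field K] [IsAlgClosed K] {n : ℕ}
    {X : Set (PSpace K n)} (hX : IsClosed X) {π : ι → Module.Dual K (Fin (n + 1) → K)}
    (hπ : ∀ v ∈ projCone X, ∃ i, π i v ≠ 0) [CommRing F] [Algebra K F]
    (χ : MvPolynomial (Fin (n + 1)) K →ₐ[K] F)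
    (hχ : ∀ f, (∀ v ∈ projCone X, MvPolynomial.eval v f = 0) → χ f = 0) :
    ∃ D : ℕ, Submodule.span K (Set.range fun i => χ (MvPolynomial.X i)) ^ (D + 1) ≤
      Submodule.span K (Set.range fun i => χ (MvPolynomial.linForm (π i))) *
        Submodule.span K (Set.range fun i => χ (MvPolynomial.X i)) ^ D := by
  obtain ⟨T, hT, hTX⟩ := hX.exists_mem_projCone_iff
  have h := MvPolynomial.exists_span_pow_succ_le hT (Φ := Set.range π) (fun v hv hφ => by
    by_contra hv0
    obtain ⟨i, hi⟩ := hπ v ((hTX v hv0).mpr hv)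
    exact hi (hφ _ ⟨i, rfl⟩)) χ (fun f hf => hχ f fun v hv => (hTX v hv.1).mp hv f hf)
  rwa [← Set.range_comp] at h

/-- Finiteness of the projection `π` on the chart where `l` is invertible. Leaving `l` arbitrary
covers both the original chart (`l = 1`) and the charts at infinity used in the slicing. -/
theorem IsClosed.isIntegral_div {K A F ι : Type*} [Field K] [IsAlgClosed K] {n : ℕ}
    {X : Set (PSpace K n)} (hX : IsClosed X) {π : ι → Module.Dual K (Fin (n + 1) → K)}
    (hπ : ∀ v ∈ projCone X, ∃ i, π i v ≠ 0) [CommRing A] [Field F] [Algebra K A] [Algebra A F]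
    [Algebra K F] [IsScalarTower K A F] (χ : MvPolynomial (Fin (n + 1)) K →ₐ[K] F)
    (hχ : ∀ f, (∀ v ∈ projCone X, MvPolynomial.eval v f = 0) → χ f = 0) {l : F}
    (hl : ∀ i, χ (MvPolynomial.linForm (π i)) / l ∈ (algebraMap A F).range)
    (φ : Module.Dual K (Fin (n + 1) → K)) :
    IsIntegral A (χ (MvPolynomial.linForm φ) / l) := by
  obtain ⟨D, hD⟩ := hX.exists_span_pow_succ_le hπ χ hχ
  refine IsIntegral.div_of_pow_succ_le (Submodule.fg_span (Set.finite_range _)) hD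
    (fun e he => ?_) ?_
  · induction he using Submodule.span_induction with
    | mem e he =>
      obtain ⟨i, rfl⟩ := he
      exact hl i
    | zero =>
      rw [zero_div]
      exact zero_mem _
    | add x y _ _ hx hy =>
      rw [add_div]
      exact add_mem hx hy
    | smul a x _ hx =>
      obtain ⟨b, hb⟩ := hx
      refine ⟨a • b, ?_⟩
      rw [Algebra.algebraMap_eq_smul_one, smul_assoc, ← Algebra.algebraMap_eq_smul_one, hb,
        smul_div_assoc]
  · rw [MvPolynomial.linForm_apply, map_sum]
    refine sum_mem fun i _ => ?_
    rw [map_smul]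
    exact Submodule.smul_mem _ _ (Submodule.subset_span ⟨i, rfl⟩)

theorem IsClosed.isIntegral_apply {K A F ι : Type*} [Field K] [IsAlgClosed K] {n : ℕ}
    {X : Set (PSpace K n)} (hX : IsClosed X) {π : ι → Module.Dual K (Fin (n + 1) → K)}
    (hπ : ∀ v ∈ projCone X, ∃ i, π i v ≠ 0) [CommRing A] [Field F] [Algebra K A] [Algebra A F]
    [Algebra K F] [IsScalarTower K A F] (χ : MvPolynomial (Fin (n + 1)) K →ₐ[K] F)
    (hχ : ∀ f, (∀ v ∈ projCone X, MvPolynomial.eval v f = 0) → χ f = 0)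
    (hl : ∀ i, χ (MvPolynomial.linForm (π i)) ∈ (algebraMap A F).range)
    (f : MvPolynomial (Fin (n + 1)) K) : IsIntegral A (χ f) := by
  induction f using MvPolynomial.induction_on with
  | C a =>
    rw [← MvPolynomial.algebraMap_eq, AlgHom.commutes, IsScalarTower.algebraMap_apply K A F]
    exact isIntegral_algebraMap
  | add p q hp hq =>
    rw [map_add]
    exact hp.add hq
  | mul_X p i hp =>
    rw [map_mul]
    refine hp.mul ?_
    have h := hX.isIntegral_div hπ χ hχ (A := A) (l := 1) (by simpa using hl) (LinearMap.proj i)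
    have hi : MvPolynomial.linForm (LinearMap.proj i : Module.Dual K (Fin (n + 1) → K)) =
        MvPolynomial.X i := by
      simp [MvPolynomial.linForm_apply, Pi.single_apply]
    rwa [div_one, hi] at h

theorem Ideal.IsPrime.exists_algHom_field {K : Type u} {R : Type v} [CommRing K] [CommRing R]
    [Algebra K R] {P : Ideal R} (hP : P.IsPrime) :
    ∃ (F : Type v) (_ : Field F) (_ : Algebra K F) (χ : R →ₐ[K] F),
      (∀ f, χ f = 0 ↔ f ∈ P) ∧ ∀ x, ∃ f g, x = χ f / χ g := by
  refine ⟨FractionRing (R ⧸ P), inferInstance, inferInstance,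
    (IsScalarTower.toAlgHom K (R ⧸ P) (FractionRing (R ⧸ P))).comp (Ideal.Quotient.mkₐ K P),
    fun f => ?_, fun x => ?_⟩
  · rw [← Ideal.Quotient.eq_zero_iff_mem]
    exact IsFractionRing.to_map_eq_zero_iff (R := R ⧸ P) (K := FractionRing (R ⧸ P))
  · obtain ⟨a, b, -, rfl⟩ := IsFractionRing.div_surjective (A := R ⧸ P) x
    obtain ⟨f, rfl⟩ := Ideal.Quotient.mk_surjective a
    obtain ⟨g, rfl⟩ := Ideal.Quotient.mk_surjective b
    exact ⟨f, g, rfl⟩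

/-! ### The dimension bound. -/

/-- A closed subset of projective space on which `k + 1` linear forms have no common zero has
dimension at most `k`. -/
theorem topologicalKrullDim_le_of_isClosed {K : Type*} [Field K] [IsAlgClosed K] {n k : ℕ}
    {X : Set (PSpace K n)} (hX : IsClosed X)
    {π : Fin (k + 1) → Module.Dual K (Fin (n + 1) → K)}
    (hπ : ∀ v ∈ projCone X, ∃ i, π i v ≠ 0) : topologicalKrullDim X ≤ (k : WithBot ℕ∞) := by
  refine iSup_le fun s => ?_
  let Z : Fin (s.length + 1) → Set (PSpace K n) := fun j => Subtype.val '' (s j : Set X)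
  have hZX : ∀ j, Z j ⊆ X := fun j => Subtype.coe_image_subset X _
  have hZc : ∀ j, IsClosed (Z j) := fun j =>
    hX.isClosedEmbedding_subtypeVal.isClosedMap _ (s j).isClosed
  have hZi : ∀ j, IsIrreducible (Z j) := fun j =>
    (s j).isIrreducible.image _ continuous_subtype_val.continuousOn
  have hZs : StrictMono Z := fun a b hab =>
    Subtype.val_injective.image_strictMono (s.strictMono hab)
  -- A chart meeting the smallest member of the chain meets all of them.
  obtain ⟨p, hp⟩ := (hZi 0).nonempty
  obtain ⟨i₀, hi₀⟩ := hπ _ (rep_mem_projCone.mpr (hZX 0 hp))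
  have hne : ∀ j, (affinePart (π i₀) (Z j)).Nonempty := fun j =>
    ⟨_, smul_inv_mem_affinePart (projCone_mono (hZs.monotone (Fin.zero_le j))
      (rep_mem_projCone.mpr hp)) hi₀⟩
  let J : Fin (s.length + 1) → Ideal (MvPolynomial (Fin (n + 1)) K) := fun j =>
    MvPolynomial.vanishingIdeal K (affinePart (π i₀) (Z j))
  have hJp : ∀ j, (J j).IsPrime := fun j => (hZi j).isPrime_vanishingIdeal_affinePart (hne j)
  let R := MvPolynomial {i // i ≠ i₀} K
  let ψ : R →ₐ[K] MvPolynomial (Fin (n + 1)) K :=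
    MvPolynomial.aeval fun i => MvPolynomial.linForm (π i)
  have hlt : ∀ a b, a < b → (J b).comap ψ.toRingHom < (J a).comap ψ.toRingHom := by
    intro a b hab
    have hJlt : J b < J a := vanishingIdeal_affinePart_lt (hZc a) (hZi b) (hZs hab) (hne a)
    obtain ⟨r, hra, hrb⟩ := Set.exists_of_ssubset (SetLike.coe_ssubset_coe.mpr hJlt)
    have := hJp b
    obtain ⟨F, _, _, χ, hχ0, -⟩ := this.exists_algHom_field (K := K)
    let : Algebra R F := (χ.comp ψ).toRingHom.toAlgebra
    have : IsScalarTower K R F := IsScalarTower.of_algebraMap_eq fun x =>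
      ((χ.comp ψ).commutes x).symm
    have hint : IsIntegral R (χ r) := by
      refine hX.isIntegral_apply hπ χ (fun f hf => (hχ0 f).mpr fun v hv => ?_) (fun i => ?_) r
      · rw [MvPolynomial.aeval_eq_eval]
        exact hf v (projCone_mono (hZX b) hv.2)
      · by_cases hi : i = i₀
        · refine ⟨1, ?_⟩
          rw [map_one, hi, ← map_one χ, eq_comm, ← sub_eq_zero, ← map_sub, hχ0]
          intro v hv
          rw [MvPolynomial.aeval_eq_eval, map_sub, MvPolynomial.eval_linForm, hv.1, map_one,
            sub_self]
        · refine ⟨MvPolynomial.X ⟨i, hi⟩, ?_⟩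
          change χ (ψ (MvPolynomial.X ⟨i, hi⟩)) = _
          rw [MvPolynomial.aeval_X]
    obtain ⟨q, hq, hqr⟩ := hint
    -- Incomparability: `r` is integral over `R` modulo `J b`, so the two primes remain distinct
    -- after contraction to the polynomial ring in `k` variables.
    refine Ideal.comap_lt_comap_of_root_mem_sdiff hJlt.le ⟨hra, hrb⟩ (p := q) ?_ ?_
    · have : ((J b).comap ψ.toRingHom).IsPrime := Ideal.comap_isPrime _ _
      exact (hq.map _).ne_zero
    · rw [← hχ0]
      have h1 := Polynomial.hom_eval₂ q ψ.toRingHom χ.toRingHom r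
      exact h1.trans hqr
  let t : LTSeries (PrimeSpectrum R)ᵒᵈ :=
    LTSeries.mk s.length
      (fun j => OrderDual.toDual ⟨(J j).comap ψ.toRingHom, Ideal.comap_isPrime _ _⟩)
      fun a b hab => hlt a b hab
  have h1 := Order.LTSeries.length_le_krullDim t
  rw [Order.krullDim_orderDual] at h1
  refine h1.trans (le_of_eq ?_)
  have h2 := MvPolynomial.ringKrullDim_of_isNoetherianRing (R := K) (ι := {i // i ≠ i₀})
  rw [ringKrullDim_eq_zero_of_field, zero_add] at h2
  refine h2.trans ?_
  simp

/-! ### A fibre in general linear position. -/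

theorem IsAlgClosed.mem_range_of_isAlgebraic {K F : Type*} [Field K] [IsAlgClosed K] [Field F]
    [Algebra K F] {a : F} (ha : IsAlgebraic K a) : a ∈ (algebraMap K F).range :=
  minpoly.mem_range_of_degree_eq_one K a
    (IsAlgClosed.degree_eq_one_of_irreducible K (minpoly.irreducible ha.isIntegral))

theorem FiniteDimensional.of_forall_exists_eq_div {L K F σ : Type*} [Field L] [CommSemiring K]
    [Field F] [Algebra L F] [Algebra K L] [Algebra K F] [IsScalarTower K L F] [Finite σ]
    (χ : MvPolynomial σ K →ₐ[K] F) (hint : ∀ i, IsIntegral L (χ (MvPolynomial.X i)))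
    (hdiv : ∀ x, ∃ f g, x = χ f / χ g) : FiniteDimensional L F := by
  let M := IntermediateField.adjoin L (Set.range fun i => χ (MvPolynomial.X i))
  have : FiniteDimensional L M := by
    have : Finite (Set.range fun i => χ (MvPolynomial.X i)) := Set.finite_range _
    refine IntermediateField.finiteDimensional_adjoin ?_
    rintro _ ⟨i, rfl⟩
    exact hint i
  have hM : ∀ f, χ f ∈ M := by
    intro f
    induction f using MvPolynomial.induction_on with
    | C a =>
      rw [← MvPolynomial.algebraMap_eq, AlgHom.commutes, IsScalarTower.algebraMap_apply K L F]
      exact M.algebraMap_mem _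
    | add p q hp hq =>
      rw [map_add]
      exact add_mem hp hq
    | mul_X p i hp =>
      rw [map_mul]
      exact mul_mem hp (IntermediateField.subset_adjoin _ _ ⟨i, rfl⟩)
  refine Module.Finite.of_surjective M.val.toLinearMap fun x => ?_
  obtain ⟨f, g, rfl⟩ := hdiv x
  exact ⟨⟨_, div_mem (hM f) (hM g)⟩, rfl⟩

theorem injective_sumElim_succ_option (k : ℕ) (ι : Type*) :
    Function.Injective (Sum.elim (fun i : Fin k => Sum.inl i.succ)
      (fun o : Option ι => o.elim (Sum.inl 0) Sum.inr) : Fin k ⊕ Option ι → Fin (k + 1) ⊕ ι) := by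
  rintro (i | _ | j) (i' | _ | j') h <;>
    simp_all [Fin.succ_ne_zero, (Fin.succ_ne_zero _).symm]

/-- Let `π` be linear forms with no common zero on an irreducible closed nondegenerate `X`, such
that the projection with components `π` maps `X` onto projective space. Then some fibre of the
projection is in general linear position with respect to complementary linear forms. -/
theorem exists_forall_fibre_eq_zero {K : Type u} [Field K] [IsAlgClosed K] [CharZero K] {n k : ℕ}
    {X : Set (PSpace K n)} (hX : IsClosed X) (hXi : IsIrreducible X)
    (hnd : ∀ φ : Module.Dual K (Fin (n + 1) → K), (∀ v ∈ projCone X, φ v = 0) → φ = 0)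
    {π : Fin (k + 1) → Module.Dual K (Fin (n + 1) → K)}
    (hπ : ∀ v ∈ projCone X, ∃ i, π i v ≠ 0)
    (hsurj : ∀ y : Fin (k + 1) → K, y ≠ 0 → ∃ v ∈ projCone X, ∀ i, π i v = y i)
    {ι : Type*} [Fintype ι] {ρ : ι → Module.Dual K (Fin (n + 1) → K)}
    (hπρ : LinearIndependent K (Sum.elim π ρ)) :
    ∃ y : Fin k → K, ∀ c : Option ι → K,
      (∀ v ∈ affinePart (π 0) X, (∀ i : Fin k, π i.succ v = y i) →
        ∑ o, c o * o.elim 1 (fun j => ρ j v) = 0) → c = 0 := by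
  have hne : (affinePart (π 0) X).Nonempty := by
    obtain ⟨v, hv, hv1⟩ := hsurj 1 one_ne_zero
    exact ⟨v, hv1 0, hv⟩
  have hP := hXi.isPrime_vanishingIdeal_affinePart hne
  obtain ⟨F, _, _, χ, hχ0, hχdiv⟩ := hP.exists_algHom_field (K := K)
  have hχ0' : ∀ f, χ f = 0 ↔ ∀ v ∈ affinePart (π 0) X, MvPolynomial.eval v f = 0 := fun f => by
    rw [hχ0, MvPolynomial.mem_vanishingIdeal_iff]
    simp only [MvPolynomial.aeval_eq_eval]
  have hχX : ∀ f, (∀ v ∈ projCone X, MvPolynomial.eval v f = 0) → χ f = 0 := fun f hf =>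
    (hχ0' f).mpr fun v hv => hf v hv.2
  have hχone : χ (MvPolynomial.linForm (π 0)) = 1 := by
    rw [← sub_eq_zero, ← map_one χ, ← map_sub, hχ0']
    intro v hv
    rw [map_sub, MvPolynomial.eval_linForm, hv.1, map_one, sub_self]
  -- By irreducibility, a linear form vanishing on the chart vanishes on the whole cone, and is zero
  -- by non-degeneracy.
  have hinj : Function.Injective (χ.toLinearMap ∘ₗ MvPolynomial.linForm) := by
    rw [← LinearMap.ker_eq_bot, LinearMap.ker_eq_bot']
    intro φ hφ
    have hφ' := (hχ0' _).mp hφ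
    refine hnd φ fun v hv => ?_
    by_contra hφv
    obtain ⟨w, hw⟩ := hne
    obtain ⟨u, hu, hφu⟩ := hXi.exists_affinePart_eval_ne_zero (η := π 0)
      (MvPolynomial.isHomogeneous_linForm φ) hv (by rwa [MvPolynomial.eval_linForm]) hw.2
      (by rw [hw.1]; exact one_ne_zero)
    exact hφu (hφ' u hu)
  let t : Fin k → F := fun i => χ (MvPolynomial.linForm (π i.succ))
  let v : ι → F := fun j => χ (MvPolynomial.linForm (ρ j))
  have hli : LinearIndependent K (Sum.elim t (fun o : Option ι => o.elim 1 v)) := by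
    convert! (hπρ.comp _ (injective_sumElim_succ_option k ι)).map' _
      (LinearMap.ker_eq_bot.mpr hinj) using 1
    funext x
    rcases x with i | _ | j
    · rfl
    · exact hχone.symm
    · rfl
  -- By surjectivity every `y` is the image of a point of the chart, so a relation between the `t i`
  -- is a polynomial vanishing on all of `K ^ k`.
  have ht : AlgebraicIndependent K t := by
    rw [algebraicIndependent_iff]
    intro p hp
    refine MvPolynomial.funext fun y => ?_
    have h1 : χ (MvPolynomial.aeval (fun i : Fin k => MvPolynomial.linForm (π i.succ)) p) = 0 := by
      rw [← hp, ← AlgHom.comp_apply, MvPolynomial.comp_aeval]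
    obtain ⟨w, hw, hwy⟩ := hsurj (Fin.cons 1 y) fun h => one_ne_zero (congrFun h 0)
    have h2 := (hχ0' _).mp h1 w ⟨hwy 0, hw⟩
    rw [← MvPolynomial.aeval_eq_eval, ← AlgHom.comp_apply, MvPolynomial.comp_aeval,
      MvPolynomial.aeval_eq_eval] at h2
    rw [map_zero, ← h2]
    congr 2
    funext i
    simp [MvPolynomial.aeval_eq_eval, hwy]
  let A := Algebra.adjoin K (Set.range t)
  let L := IntermediateField.adjoin K (Set.range t)
  have htA : ∀ i, t i ∈ A := fun i => Algebra.subset_adjoin ⟨i, rfl⟩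
  have hint : ∀ f, IsIntegral A (χ f) := by
    refine hX.isIntegral_apply hπ χ hχX fun i => ?_
    refine Fin.cases ?_ (fun i => ?_) i
    · rw [hχone]
      exact one_mem _
    · exact ⟨⟨t i, htA i⟩, rfl⟩
  have hfd : FiniteDimensional L F :=
    FiniteDimensional.of_forall_exists_eq_div χ (fun i => (hint _).tower_top) hχdiv
  have hcore := linearIndependent_adjoin_of_isIntegral v k
    (fun _ a ha => IsAlgClosed.mem_range_of_isAlgebraic ha) t ht hfd hli (fun j => hint _)
    (fun l _ _ j => hX.isIntegral_div hπ χ hχX (fun i => by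
      refine Fin.cases ?_ (fun i => ?_) i
      · rw [hχone, one_div]
        exact ⟨⟨l⁻¹, Algebra.subset_adjoin (Set.mem_insert _ _)⟩, rfl⟩
      · exact ⟨⟨t i / l, Algebra.subset_adjoin (Set.mem_insert_of_mem _ ⟨i, rfl⟩)⟩, rfl⟩) (ρ j))
  have : IsIntegrallyClosed A := IsIntegrallyClosed.of_equiv ht.aevalEquiv.toRingEquiv
  let g : Option ι → integralClosure A F := fun o => o.elim 1 fun j => ⟨v j, hint _⟩
  have hg : LinearIndependent L fun o => (g o : F) := by
    convert! hcore using 1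
    funext o
    rcases o with _ | j <;> rfl
  obtain ⟨Δ, hΔ0, hΔ⟩ := exists_forall_fibre_linearIndependent (A := A) (K := K) hg
  obtain ⟨y, hy⟩ : ∃ y, MvPolynomial.eval y (ht.aevalEquiv.symm Δ) ≠ 0 := by
    by_contra! hcon
    refine hΔ0 (ht.aevalEquiv.symm.injective ?_)
    rw [map_zero]
    exact MvPolynomial.funext fun y => by rw [hcon, map_zero]
  let ev : A →+* K := (MvPolynomial.eval y).comp ht.aevalEquiv.symm.toRingHom
  have hevK : ∀ a, ev (algebraMap K A a) = a := fun a => by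
    change MvPolynomial.eval y (ht.aevalEquiv.symm (algebraMap K A a)) = a
    rw [AlgEquiv.commutes, MvPolynomial.algebraMap_eq, MvPolynomial.eval_C]
  have hevt : ∀ i, ev ⟨t i, htA i⟩ = y i := fun i => by
    change MvPolynomial.eval y (ht.aevalEquiv.symm ⟨t i, htA i⟩) = y i
    have : ht.aevalEquiv.symm ⟨t i, htA i⟩ = MvPolynomial.X i := by
      rw [AlgEquiv.symm_apply_eq]
      ext
      simp
    rw [this, MvPolynomial.eval_X]
  refine ⟨y, fun c hc => hΔ ev (fun a => ⟨_, hevK a⟩) hy c fun φ hφ => ?_⟩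
  let χ' : MvPolynomial (Fin (n + 1)) K →+* integralClosure A F :=
    χ.toRingHom.codRestrict (integralClosure A F).toSubring hint
  -- The point of the fibre corresponding to `φ`: it lies on `X` because `χ'` kills the vanishing
  -- ideal of the chart, and over `y` because `φ` restricts to `ev`.
  let w : Fin (n + 1) → K := fun i => φ (χ' (MvPolynomial.X i))
  have hφA : ∀ a : A, φ (algebraMap A _ a) = ev a := fun a => RingHom.congr_fun hφ a
  have hφχ : φ.comp χ' = MvPolynomial.eval w := by
    refine MvPolynomial.ringHom_ext (fun a => ?_) fun i => ?_
    · rw [MvPolynomial.eval_C]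
      refine Eq.trans ?_ (hevK a)
      rw [← hφA]
      exact congrArg φ (Subtype.ext (χ.commutes a))
    · rw [MvPolynomial.eval_X]
      rfl
  have hφlin : ∀ ψ : Module.Dual K (Fin (n + 1) → K), φ (χ' (MvPolynomial.linForm ψ)) = ψ w :=
    fun ψ => by rw [← MvPolynomial.eval_linForm ψ w, ← hφχ]; rfl
  have hw : w ∈ affinePart (π 0) X := by
    rw [← zeroLocus_vanishingIdeal_affinePart hX]
    intro f hf
    have h1 : χ' f = 0 := Subtype.ext ((hχ0 f).mpr hf)
    rw [MvPolynomial.aeval_eq_eval, ← hφχ, RingHom.comp_apply, h1, map_zero]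
  have h1 := hc w hw fun i => by
    rw [← hφlin, ← hevt i, ← hφA]
    rfl
  rw [← h1]
  refine Finset.sum_congr rfl fun o _ => ?_
  rcases o with _ | j
  · exact congrArg (c none * ·) (map_one φ)
  · exact congrArg (c (some j) * ·) (hφlin (ρ j))

/-! ### Linear algebra of the centre `W`, and conclusion. -/

theorem forall_projCone_eq_zero_imp {K : Type*} [Field K] {n : ℕ} {X : Set (PSpace K n)}
    (hX : Projectivization.Subspace.span X = ⊤) (φ : Module.Dual K (Fin (n + 1) → K))
    (hφ : ∀ v ∈ projCone X, φ v = 0) : φ = 0 := by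
  have h : Projectivization.Subspace.span X ≤ Submodule.projectivization (LinearMap.ker φ) := by
    rw [Projectivization.Subspace.span_le_subspace_iff]
    intro p hp
    have h1 := hφ _ (rep_mem_projCone.mpr hp)
    rw [← Projectivization.mk_rep p]
    exact (Submodule.mk_mem_projectivization_iff _ _).mpr h1
  ext v
  have h2 : (Pi.single v 1 : Fin (n + 1) → K) ≠ 0 := by simp
  rw [hX, top_le_iff] at h
  have h3 : Projectivization.mk K _ h2 ∈ Submodule.projectivization (LinearMap.ker φ) := by
    rw [h]
    rw [← Projectivization.Subspace.span_univ]
    exact Projectivization.Subspace.subset_span _ trivial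
  exact (Submodule.mk_mem_projectivization_iff _ _).mp h3

/-- If `u` is outside a maximal `W`, the span of `W` and `u` contains some `w + a • u` in the cone,
with `a ≠ 0` since `W` misses it; divide by `a`. The last clause is surjectivity of the projection
from `W`. -/
theorem exists_maximal_disjoint_projCone {K : Type*} [Field K] {n : ℕ} {X : Set (PSpace K n)}
    {V : Submodule K (Fin (n + 1) → K)} (hV : ∀ v ∈ V, v ∉ projCone X) :
    ∃ W : Submodule K (Fin (n + 1) → K), V ≤ W ∧ (∀ v ∈ W, v ∉ projCone X) ∧
      ∀ u, u ∉ W → ∃ w ∈ W, u + w ∈ projCone X := by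
  obtain ⟨W, ⟨hVW, hW⟩, hmax⟩ := (wellFounded_gt (α := Submodule K (Fin (n + 1) → K))).has_min
    {W | V ≤ W ∧ ∀ v ∈ W, v ∉ projCone X} ⟨V, le_rfl, hV⟩
  refine ⟨W, hVW, hW, fun u hu => ?_⟩
  have hlt : W < W ⊔ Submodule.span K {u} :=
    lt_of_le_of_ne le_sup_left fun h => hu (by
      rw [h]
      exact Submodule.mem_sup_right (Submodule.mem_span_singleton_self u))
  obtain ⟨x, hx, hxX⟩ : ∃ x ∈ W ⊔ Submodule.span K {u}, x ∈ projCone X := by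
    by_contra! hcon
    exact hmax _ ⟨hVW.trans hlt.le, hcon⟩ hlt
  obtain ⟨w, hw, z, hz, rfl⟩ := Submodule.mem_sup.mp hx
  obtain ⟨a, rfl⟩ := Submodule.mem_span_singleton.mp hz
  have ha : a ≠ 0 := by
    rintro rfl
    rw [zero_smul, add_zero] at hxX
    exact hW w hw hxX
  refine ⟨a⁻¹ • w, W.smul_mem _ hw, ?_⟩
  have h1 := smul_mem_projCone hxX (inv_ne_zero ha)
  rwa [smul_add, smul_smul, inv_mul_cancel₀ ha, one_smul, add_comm _ u] at h1

theorem Submodule.exists_basis_mem_iff {K E : Type*} [Field K] [AddCommGroup E] [Module K E]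
    [FiniteDimensional K E] (W : Submodule K E) :
    ∃ (c r : ℕ) (B : Module.Basis (Fin c ⊕ Fin r) K E),
      (∀ v, v ∈ W ↔ ∀ i, B.coord (Sum.inl i) v = 0) := by
  obtain ⟨W', h⟩ := W.exists_isCompl
  let B₁ := Module.finBasis K W'
  let B₂ := Module.finBasis K W
  refine ⟨_, _, (B₁.prod B₂).map (Submodule.prodEquivOfIsCompl W' W h.symm), fun v => ?_⟩
  rw [← Submodule.prodEquivOfIsCompl_symm_apply_fst_eq_zero W' W h.symm,
    ← B₁.forall_coord_eq_zero_iff]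
  rfl

theorem subspaceRank_le_of_le_span {K : Type*} [Field K] {n r : ℕ} {X : Set (PSpace K n)}
    {V : Projectivization.Subspace K (Fin (n + 1) → K)} {Φ : Set (Fin (n + 1) → K)}
    (hΦ : Φ ⊆ projCone X) (hV : Projectivization.Subspace.submodule V ≤ Submodule.span K Φ)
    (hr : Module.finrank K (Submodule.span K Φ) ≤ r) : subspaceRank X V ≤ r := by
  classical
  obtain ⟨b, hbΦ, hspan, hli⟩ := exists_linearIndependent K Φ
  have : Finite b := hli.finite
  have : Fintype b := Fintype.ofFinite b
  let S : Finset (PSpace K n) :=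
    Finset.univ.image fun v : b => Projectivization.mk K (v : Fin (n + 1) → K) (hΦ (hbΦ v.2)).1
  have hSX : (S : Set (PSpace K n)) ⊆ X := by
    intro p hp
    obtain ⟨v, -, rfl⟩ := Finset.mem_image.mp hp
    exact (hΦ (hbΦ v.2)).2
  have hcard : S.card ≤ r := by
    refine Finset.card_image_le.trans ((le_of_eq ?_).trans hr)
    rw [← hspan, finrank_span_set_eq_card hli, Set.toFinset_card, Finset.card_univ]
  have hVS : V ≤ Projectivization.Subspace.span (S : Set (PSpace K n)) := by
    rw [← Projectivization.Subspace.submodule.le_iff_le]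
    refine hV.trans ?_
    rw [← hspan, Submodule.span_le]
    intro v hv
    refine (Projectivization.Subspace.mem_submodule_iff _ (hΦ (hbΦ hv)).1).mpr ?_
    exact Projectivization.Subspace.subset_span _
      (Finset.mem_image_of_mem (fun v : b => Projectivization.mk K (v : Fin (n + 1) → K) _)
        (Finset.mem_univ ⟨v, hv⟩))
  have hrank : subspaceRank X V ≤ S.card := sInf_le ⟨S, hSX, hVS, rfl⟩
  exact hrank.trans (Nat.cast_le.mpr hcard)

theorem proposition3 {K : Type*} [Field K] [IsAlgClosed K] [CharZero K] (n m : ℕ)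
    (X : Set (PSpace K n)) (hX_closed : IsClosed X) (hX_irred : IsIrreducible X)
    (hX_dim : topologicalKrullDim X = (m : WithBot ℕ∞))
    (hX_nondeg : Projectivization.Subspace.span X = ⊤)
    (V : Projectivization.Subspace K (Fin (n + 1) → K))
    (hVX : (V : Set (PSpace K n)) ∩ X = ∅) :
    subspaceRank X V + (m : ℕ∞) ≤ (n : ℕ∞) + 1 := by
  have hV : ∀ v ∈ Projectivization.Subspace.submodule V, v ∉ projCone X := by
    rintro v hv ⟨hv0, hvX⟩
    rw [Projectivization.Subspace.mem_submodule_iff _ hv0] at hv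
    exact Set.eq_empty_iff_forall_notMem.mp hVX _ ⟨hv, hvX⟩
  obtain ⟨W, hVW, hW, hWmax⟩ := exists_maximal_disjoint_projCone hV
  obtain ⟨c, r, B, hB⟩ := W.exists_basis_mem_iff
  have hπ : ∀ v ∈ projCone X, ∃ i, B.coord (Sum.inl i) v ≠ 0 := by
    intro v hv
    by_contra! hcon
    exact hW v ((hB v).mpr hcon) hv
  obtain ⟨p, hp⟩ := hX_irred.nonempty
  -- `X` is nonempty and misses `W`, so `W` is a proper subspace.
  obtain ⟨k, rfl⟩ : ∃ k, c = k + 1 := by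
    obtain ⟨i, -⟩ := hπ _ (rep_mem_projCone.mpr hp)
    exact Nat.exists_eq_add_one.mpr i.pos
  have hsurj : ∀ y : Fin (k + 1) → K, y ≠ 0 →
      ∃ v ∈ projCone X, ∀ i, B.coord (Sum.inl i) v = y i := by
    intro y hy
    let u := B.equivFun.symm (Sum.elim y 0)
    have hu : ∀ i, B.coord (Sum.inl i) u = y i := fun i => by
      change B.equivFun (B.equivFun.symm (Sum.elim y 0)) (Sum.inl i) = y i
      rw [LinearEquiv.apply_symm_apply, Sum.elim_inl]
    obtain ⟨w, hw, huw⟩ := hWmax u fun h => hy (funext fun i => by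
      rw [← hu, (hB u).mp h i, Pi.zero_apply])
    exact ⟨_, huw, fun i => by rw [map_add, hu, (hB w).mp hw i, add_zero]⟩
  have hm : m ≤ k := by
    have h1 := topologicalKrullDim_le_of_isClosed hX_closed hπ
    rw [hX_dim] at h1
    exact_mod_cast h1
  have hdim : k + 1 + r = n + 1 := by
    have h1 := Module.finrank_eq_card_basis B
    simpa using h1.symm
  have hli : LinearIndependent K
      (Sum.elim (fun i => B.coord (Sum.inl i)) fun j => B.coord (Sum.inr j)) := by
    have h1 := B.dualBasis.linearIndependent
    rw [B.coe_dualBasis] at h1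
    convert! h1 using 1
    funext x
    cases x <;> rfl
  obtain ⟨y, hy⟩ := exists_forall_fibre_eq_zero hX_closed hX_irred
    (forall_projCone_eq_zero_imp hX_nondeg) hπ hsurj hli
  let y' : Fin (k + 1) → K := Fin.cons 1 y
  let Φ : Set (Fin (n + 1) → K) :=
    {v | v ∈ affinePart (B.coord (Sum.inl 0)) X ∧ ∀ i : Fin k, B.coord (Sum.inl i.succ) v = y i}
  have hΦy : ∀ v ∈ Φ, ∀ i, B.coord (Sum.inl i) v = y' i := fun v hv i =>
    Fin.cases hv.1.1 hv.2 i
  have hsum : ∀ v, v = ∑ i, B.coord (Sum.inl i) v • B (Sum.inl i) +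
      ∑ j, B.coord (Sum.inr j) v • B (Sum.inr j) := fun v => by
    conv_lhs => rw [← B.sum_repr v, Fintype.sum_sum_type]
    rfl
  have hWΦ : W ≤ Submodule.span K Φ := by
    intro w hw
    by_contra hwΦ
    obtain ⟨φ, hφw, hφ⟩ := Submodule.exists_le_ker_of_notMem hwΦ
    -- On the fibre the first coordinates are fixed to `y'`, so `φ` becomes a constant plus a
    -- combination of the other coordinates. Its vanishing there forces `φ` to kill the basis of
    -- `W`, against `φ w ≠ 0`.
    have h0 := hy (fun o => o.elim (∑ i, y' i * φ (B (Sum.inl i))) fun j => φ (B (Sum.inr j)))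
      fun v hvX hv => by
        have hv' : v ∈ Φ := ⟨hvX, hv⟩
        have h1 : φ v = 0 := hφ (Submodule.subset_span hv')
        rw [hsum v] at h1
        simp only [map_add, map_sum, map_smul, smul_eq_mul, hΦy v hv'] at h1
        rw [← h1, Fintype.sum_option]
        simp [mul_comm]
    refine hφw ?_
    rw [hsum w, map_add, map_sum, map_sum]
    have h2 : ∀ j, φ (B (Sum.inr j)) = 0 := fun j => congrFun h0 (some j)
    simp [h2, -Module.Basis.coord_apply, (hB w).mp hw]
  -- The fibre lies in the span of `W` and the single vector with first coordinates `y'`.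
  have hfin : Module.finrank K (Submodule.span K Φ) ≤ r + 1 := by
    let g : Option (Fin r) → Fin (n + 1) → K := fun o =>
      o.elim (∑ i, y' i • B (Sum.inl i)) fun j => B (Sum.inr j)
    have hle : Submodule.span K Φ ≤ Submodule.span K (Set.range g) := by
      rw [Submodule.span_le]
      intro v hv
      rw [hsum v]
      refine add_mem ?_ (sum_mem fun j _ => Submodule.smul_mem _ _
        (Submodule.subset_span ⟨some j, rfl⟩))
      refine Submodule.subset_span ⟨none, ?_⟩
      simp only [hΦy v hv]
      rfl
    refine (Submodule.finrank_mono hle).trans ((finrank_range_le_card g).trans ?_)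
    simp
  have hrank := subspaceRank_le_of_le_span (fun v (hv : v ∈ Φ) => hv.1.2) (hVW.trans hWΦ) hfin
  calc subspaceRank X V + (m : ℕ∞) ≤ ((r + 1 : ℕ) : ℕ∞) + (k : ℕ∞) :=
        add_le_add hrank (Nat.cast_le.mpr hm)
    _ = ((n + 1 : ℕ) : ℕ∞) := by
        rw [← Nat.cast_add, ← hdim]
        congr 1
        ring
    _ = (n : ℕ∞) + 1 := by push_cast; rfl
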